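/- Let $M$ be a smooth surface, $f:M\to\mathbb E^3$ a smooth immersion ($M$ carries the induced metric) with smooth unit normal field $N$, and let $\vec k\in\mathbb E^3$ be a fixed unit vector. Let $\theta=\angle(N,\vec k)$ be the angle function, let $U$ be the tangent part of $\vec k$, so that $\vec k=U+\cos\theta\,N$, let $A$ be the shape operator, $dN(X)=-AX$, and let $K=\det A$ be the Gaussian curvature. We say that $U$ is a \emph{canonical principal direction} if at every point $U\neq0$ (i.e. $\theta\in(0,\pi)$) and $AU=\lambda U$ with $\lambda\neq0$. Suppose that $U$ is a canonical principal direction. Consider the following two cases for a point $p\in M$: there are local coordinates $(x,y)$ on a neighbourhood of $p$, in which the angle function is a smooth function $\theta=\theta(x)\in(0,\pi)$ with $\theta'\neq 0$ on an open interval $I\ni0$, and a primitive $\phi$ of $\cos\theta$ on $I$, such that, after an isometry of $\mathbb E^3$ whose linear part maps $\vec k$ to $(0,0,1)$, the immersion is Case 1: $$r(x,y)=\Big(\phi(x)(\cos y,\sin y)+\gamma(y),\ \int_0^x\sin\theta(\tau)\,d\tau\Big),\qquad \gamma(y)=\Big(-\int_0^y\psi(\tau)\sin\tau\,d\tau,\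 \int_0^y\psi(\tau)\cos\tau\,d\tau\Big),$$ where $\psi$ is a smooth function on an open interval $J\ni 0$ and $\phi(x)+\psi(y)\ne0$ on the coordinate domain; or Case 2: $$r(x,y)=\Big(\phi(x)\cos y_0,\ \phi(x)\sin y_0,\ \int_0^x\sin\theta(\tau)\,d\tau\Big)+y\,\mathrm v_0,\qquad \mathrm v_0=(-\sin y_0,\cos y_0,0),\ y_0\in\mathbb R$$ (a cylinder). Then Case 1 holds near every point $p$ with $K(p)\neq0$, and Case 2 holds near every point $p$ such that $K=0$ on a neighbourhood of $p$; in particular the points near which the surface is given by one of the two cases form a dense set. Conversely, let $\theta$ be a smooth function with values in $(0,\pi)$ and nowhere vanishing derivative on an open interval $I\ni0$, let $\phi$ be a primitive of $\cos\theta$ on $I$, and let $\psi$ be a smooth function on an open interval $J\ni 0$ (Case 1), or $y_0\in\mathbb R$ (Case 2). If, in global coordinates $(x,y)$ on $M$ (with $x\in I$, and in Case 1 $y\in J$ and $\phi(x)+\psi(y)\neq0$), and up to an isometry of $\mathbb E^3$ whose linear part maps $\vec k$ to $(0,0,1)$, a map $M\to\mathbb E^3$ is given by the formula of Case 1 or of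 Case 2, then it is a smooth immersion, it has a smooth unit normal field whose angle function is $\theta(x)$, and $U$ is a canonical principal direction of it. -/

import Mathlib

open scoped Manifold ContDiff

noncomputable section

namespace CanonicalDirection

/-- The coordinate plane of the parameters `(x, y)`. -/
abbrev E2 : Type := EuclideanSpace ℝ (Fin 2)

/-- Euclidean 3-space. -/
abbrev E3 : Type := EuclideanSpace ℝ (Fin 3)

/-- The vertical unit vector `(0, 0, 1)`. -/
def e3 : E3 := !₂[0, 0, 1]

section Surfaces

variable {M : Type*} [TopologicalSpace M] [ChartedSpace E2 M]

/-- The differential at `p` of a map from a surface `M` to `E3`. -/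
def diff (f : M → E3) (p : M) : TangentSpace (𝓡 2) p →L[ℝ] E3 :=
  mfderiv (𝓡 2) 𝓘(ℝ, E3) f p

/-- `f : M → E3` is a smooth immersion. It is an isometric immersion for the metric that it induces
on `M`. -/
structure IsSmoothImmersion (f : M → E3) : Prop where
  smooth : ContMDiff (𝓡 2) 𝓘(ℝ, E3) ∞ f
  injective : ∀ p, Function.Injective (diff f p)

/-- `N` is a smooth unit normal field along `f`. -/
structure IsUnitNormal (f N : M → E3) : Prop where
  smooth : ContMDiff (𝓡 2) 𝓘(ℝ, E3) ∞ N
  norm_eq_one : ∀ p, ‖N p‖ = 1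
  orthogonal : ∀ p v, inner ℝ (N p) (diff f p v) = 0

/-- For a vector `w` of `E3` that is tangent to the immersed surface at `p`, the vector of `T_p M`
that corresponds to `w` under the differential of the immersion. -/
def toTangent (f : M → E3) (p : M) : E3 →ₗ[ℝ] TangentSpace (𝓡 2) p :=
  (diff f p).toLinearMap.leftInverse

/-- The tangent part `U` of the fixed direction `k`, determined by `k = U + cos θ N`, where
`cos θ = ⟨k, N⟩`. -/
def tangentPart (f N : M → E3) (k : E3) (p : M) : TangentSpace (𝓡 2) p :=
  toTangent f p (k - inner ℝ k (N p) • N p)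

/-- The shape operator `A`, determined by the Weingarten formula `dN(X) = - A X`. -/
def shapeOperator (f N : M → E3) (p : M) :
    TangentSpace (𝓡 2) p →ₗ[ℝ] TangentSpace (𝓡 2) p :=
  -(toTangent f p ∘ₗ (diff N p).toLinearMap)

/-- The Gaussian curvature `K = det A`. -/
def gaussCurvature (f N : M → E3) (p : M) : ℝ :=
  LinearMap.det (shapeOperator f N p)

/-- `U` is a canonical principal direction: at every point it is a principal direction (in
particular nonzero, so that the angle function takes its values in `(0, π)`), and the corresponding
principal curvature is different from zero. -/
def IsCanonicalPrincipal (f N : M → E3) (k : E3) : Prop :=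
  ∀ p, tangentPart f N k p ≠ 0 ∧
    ∃ c : ℝ, c ≠ 0 ∧ shapeOperator f N p (tangentPart f N k p) = c • tangentPart f N k p

theorem mem_range_of_inner_eq_zero {f N : M → E3} (hf : IsSmoothImmersion f)
    (hN : IsUnitNormal f N) {p : M} {w : E3} (hw : inner ℝ (N p) w = 0) :
    ∃ v, diff f p v = w := by
  have h1 : (diff f p).toLinearMap.range ≤ (ℝ ∙ (N p))ᗮ := by
    rintro _ ⟨v, rfl⟩
    exact Submodule.mem_orthogonal_singleton_iff_inner_right.2 (hN.orthogonal p v)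
  have hN0 : N p ≠ 0 := by
    intro h
    have := hN.norm_eq_one p
    simp [h] at this
  have h2 : Module.finrank ℝ (diff f p).toLinearMap.range = 2 := by
    rw [LinearMap.finrank_range_of_inj (hf.injective p)]
    exact finrank_euclideanSpace_fin
  have : Fact (Module.finrank ℝ E3 = 2 + 1) := ⟨finrank_euclideanSpace_fin⟩
  have h3 : Module.finrank ℝ (ℝ ∙ (N p))ᗮ = 2 := Submodule.finrank_orthogonal_span_singleton hN0
  have h4 := Submodule.eq_of_le_of_finrank_eq h1 (h2.trans h3.symm)
  have h5 : w ∈ (diff f p).toLinearMap.range := by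
    rw [h4]
    exact Submodule.mem_orthogonal_singleton_iff_inner_right.2 hw
  exact h5

theorem diff_toTangent {f N : M → E3} (hf : IsSmoothImmersion f)
    (hN : IsUnitNormal f N) {p : M} {w : E3} (hw : inner ℝ (N p) w = 0) :
    diff f p (toTangent f p w) = w := by
  obtain ⟨v, rfl⟩ := mem_range_of_inner_eq_zero hf hN hw
  congr 1
  exact LinearMap.leftInverse_apply_of_inj (LinearMap.ker_eq_bot.2 (hf.injective p)) v

/-- The decomposition `k = U + cos θ N`. -/
theorem diff_tangentPart {f N : M → E3} (hf : IsSmoothImmersion f)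
    (hN : IsUnitNormal f N) (k : E3) (p : M) :
    diff f p (tangentPart f N k p) + inner ℝ k (N p) • N p = k := by
  have h : inner ℝ (N p) (k - inner ℝ k (N p) • N p) = 0 := by
    rw [inner_sub_right, inner_smul_right, real_inner_self_eq_norm_sq, hN.norm_eq_one p,
      real_inner_comm]
    ring
  rw [tangentPart, diff_toTangent hf hN h]
  abel

/-- The Weingarten formula. -/
theorem diff_shapeOperator {f N : M → E3} (hf : IsSmoothImmersion f)
    (hN : IsUnitNormal f N) (p : M) (v : TangentSpace (𝓡 2) p) :
    diff f p (shapeOperator f N p v) = - diff N p v := by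
  have hd : MDifferentiableAt (𝓡 2) 𝓘(ℝ, E3) N p :=
    (hN.smooth p).mdifferentiableAt (by simp)
  have h : inner ℝ (N p) (diff N p v) = 0 := by
    have e1 : HasMFDerivAt (𝓡 2) 𝓘(ℝ, ℝ) (fun q => ‖N q‖ ^ 2) p
        ((2 • (innerSL ℝ (N p))).comp (diff N p)) :=
      HasMFDerivAt.comp p (hasStrictFDerivAt_norm_sq (N p)).hasFDerivAt.hasMFDerivAt
        hd.hasMFDerivAt
    have e2 : (fun q => ‖N q‖ ^ 2) = fun _ => (1 : ℝ) := by
      funext q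
      simp [hN.norm_eq_one q]
    rw [e2] at e1
    have d1 := hasMFDerivAt_unique e1 (hasMFDerivAt_const (1 : ℝ) p)
    have d2 : (2 • innerSL ℝ (N p)) (diff N p v) = (0 : ℝ) := congrArg (fun L => L v) d1
    have d3 : inner ℝ (N p) (diff N p v) + inner ℝ (N p) (diff N p v) = (0 : ℝ) := by
      rw [two_smul] at d2
      exact d2
    linarith
  have h2 := diff_toTangent hf hN h
  simp only [shapeOperator, LinearMap.neg_apply, map_neg]
  exact congrArg Neg.neg h2

end Surfaces

/-- `I` is an open interval that contains `0`. -/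
def IsIntervalAboutZero (I : Set ℝ) : Prop :=
  IsOpen I ∧ I.OrdConnected ∧ (0 : ℝ) ∈ I

/-- `θ` is a smooth function on `I` with values in `(0, π)` and nowhere vanishing derivative, and
`φ` is a primitive of `cos θ` on `I`. -/
structure IsAngleData (I : Set ℝ) (θ φ : ℝ → ℝ) : Prop where
  interval : IsIntervalAboutZero I
  smooth : ContDiffOn ℝ ∞ θ I
  mem_Ioo : ∀ x ∈ I, θ x ∈ Set.Ioo 0 Real.pi
  deriv_ne_zero : ∀ x ∈ I, deriv θ x ≠ 0
  primitive : ∀ x ∈ I, HasDerivAt φ (Real.cos (θ x)) x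

/-- The parametrization of Case 1,
`r(x, y) = (φ(x) (cos y, sin y) + γ(y), ∫_0^x sin θ)` with
`γ(y) = (- ∫_0^y ψ(τ) sin τ dτ, ∫_0^y ψ(τ) cos τ dτ)`. -/
def caseOne (θ φ ψ : ℝ → ℝ) (x y : ℝ) : E3 :=
  !₂[φ x * Real.cos y + -∫ τ in (0 : ℝ)..y, ψ τ * Real.sin τ,
     φ x * Real.sin y + ∫ τ in (0 : ℝ)..y, ψ τ * Real.cos τ,
     ∫ τ in (0 : ℝ)..x, Real.sin (θ τ)]

/-- The parametrization of Case 2,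
`r(x, y) = (φ(x) cos y₀, φ(x) sin y₀, ∫_0^x sin θ) + y v₀` with `v₀ = (- sin y₀, cos y₀, 0)`. -/
def caseTwo (θ φ : ℝ → ℝ) (y₀ : ℝ) (x y : ℝ) : E3 :=
  !₂[φ x * Real.cos y₀, φ x * Real.sin y₀, ∫ τ in (0 : ℝ)..x, Real.sin (θ τ)] +
    y • !₂[-Real.sin y₀, Real.cos y₀, 0]

section Cases

variable {M : Type*} [TopologicalSpace M] [ChartedSpace E2 M]

/-- In the local coordinates `(x, y)` of the chart `e` of `M`, and after an isometry of `E3` that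
turns the fixed direction `k` into the vertical direction, `f` is the surface of Case 1 with
the functions `θ`, `φ` on `I` and `ψ` on `J`. The condition `φ + ψ ≠ 0` says that this
parametrization is regular. -/
structure IsCaseOne (f : M → E3) (k : E3) (e : OpenPartialHomeomorph M E2)
    (θ φ ψ : ℝ → ℝ) (I J : Set ℝ) : Prop where
  chart : e ∈ IsManifold.maximalAtlas (𝓡 2) ∞ M
  target : ∀ z ∈ e.target, z 0 ∈ I ∧ z 1 ∈ J
  angleData : IsAngleData I θ φ
  interval : IsIntervalAboutZero J
  smooth : ContDiffOn ℝ ∞ ψ J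
  regular : ∀ z ∈ e.target, φ (z 0) + ψ (z 1) ≠ 0
  formula : ∃ F : E3 ≃ᵃⁱ[ℝ] E3, F.linearIsometryEquiv k = e3 ∧
    ∀ q ∈ e.source, F (f q) = caseOne θ φ ψ (e q 0) (e q 1)

/-- In the local coordinates `(x, y)` of the chart `e` of `M`, and after an isometry of `E3` that
turns the fixed direction `k` into the vertical direction, `f` is the cylinder of Case 2 with
the functions `θ`, `φ` on `I` and the constant `y₀`. -/
structure IsCaseTwo (f : M → E3) (k : E3) (e : OpenPartialHomeomorph M E2)
    (θ φ : ℝ → ℝ) (y₀ : ℝ) (I : Set ℝ) : Prop where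
  chart : e ∈ IsManifold.maximalAtlas (𝓡 2) ∞ M
  target : ∀ z ∈ e.target, z 0 ∈ I
  angleData : IsAngleData I θ φ
  formula : ∃ F : E3 ≃ᵃⁱ[ℝ] E3, F.linearIsometryEquiv k = e3 ∧
    ∀ q ∈ e.source, F (f q) = caseTwo θ φ y₀ (e q 0) (e q 1)

/-- On the domain of the chart `e`, the angle function of the surface is `θ(x)`. -/
def HasAngle (N : M → E3) (k : E3) (e : OpenPartialHomeomorph M E2) (θ : ℝ → ℝ) : Prop :=
  ∀ q ∈ e.source, InnerProductGeometry.angle (N q) k = θ (e q 0)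

/-- Near `p` the surface is given by Case 1, where `θ` is its angle function. -/
def IsCaseOneNear (f N : M → E3) (k : E3) (p : M) : Prop :=
  ∃ (e : OpenPartialHomeomorph M E2) (θ φ ψ : ℝ → ℝ) (I J : Set ℝ),
    p ∈ e.source ∧ IsCaseOne f k e θ φ ψ I J ∧ HasAngle N k e θ

/-- Near `p` the surface is given by Case 2, where `θ` is its angle function. -/
def IsCaseTwoNear (f N : M → E3) (k : E3) (p : M) : Prop :=
  ∃ (e : OpenPartialHomeomorph M E2) (θ φ : ℝ → ℝ) (y₀ : ℝ) (I : Set ℝ),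
    p ∈ e.source ∧ IsCaseTwo f k e θ φ y₀ I ∧ HasAngle N k e θ

/-- `f` is an immersed surface with a unit normal field whose angle function is `θ(x)`, and `U` is
a canonical principal direction of it, whichever unit normal field is used. -/
def IsCanonicalSurface (f : M → E3) (k : E3) (e : OpenPartialHomeomorph M E2)
    (θ : ℝ → ℝ) : Prop :=
  IsSmoothImmersion f ∧ (∃ N, IsUnitNormal f N ∧ HasAngle N k e θ) ∧
    ∀ N, IsUnitNormal f N → IsCanonicalPrincipal f N k

end Cases

end CanonicalDirection

end

/-!
Let `k` be the vertical unit vector. The unit normal is then `cos θ • k - sin θ • (cos y, sin y, 0)`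
for a polar angle `y`, and the tangent plane has the orthonormal basis formed by the meridian vector
`cos θ • (cos y, sin y, 0) + sin θ • k`, which is the direction of `U`, and the horizontal vector
`(-sin y, cos y, 0)`. Let `ω₁`, `ω₂` be the dual frame, so that `df` is `ω₁` times the first vector
plus `ω₂` times the second. That `U` is principal means that `dθ` is a multiple of `ω₁` and `dy` a
multiple of `ω₂`, and `λ ≠ 0` means that `dθ ≠ 0`. The height has the differential `sin θ • ω₁`, so
`θ` is locally a function of it, and `ω₁ = dx` for the arc length `x` of the meridians; thus
`θ = θ(x)`.

If `K ≠ 0`, then `dy ≠ 0` and `(x, y)` are coordinates. The derivative of the profile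
`φ(x) • (cos y, sin y, 0) + (∫ sin θ) • k` has the same component along `ω₁` as `df`, so that the
difference of `f` and the profile is a function of `y` alone whose derivative is a multiple of
`(-sin y, cos y, 0)`: this is the curve `γ`. If `K = 0`, then `y` is constant and the same
comparison shows that the difference is a straight line parametrized by arc length.
-/

noncomputable section

namespace CanonicalDirection

section Calculus

variable {E F G : Type*} [NormedAddCommGroup E] [NormedSpace ℝ E] [NormedAddCommGroup F]
  [NormedSpace ℝ F] [NormedAddCommGroup G] [NormedSpace ℝ G]

theorem hasDerivAt_integral_of_continuousOn [CompleteSpace E] {I : Set ℝ} (hI : IsOpen I)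
    (hc : I.OrdConnected) {g : ℝ → E} (hg : ContinuousOn g I) {a b : ℝ} (ha : a ∈ I) (hb : b ∈ I) :
    HasDerivAt (fun t => ∫ τ in a..t, g τ) (g b) b :=
  intervalIntegral.integral_hasDerivAt_right (hg.mono (hc.uIcc_subset ha hb)).intervalIntegrable
    (hg.stronglyMeasurableAtFilter hI b hb) (hg.continuousAt (hI.mem_nhds hb))

theorem contDiffOn_of_hasDerivAt {I : Set ℝ} (hI : IsOpen I) {g g' : ℝ → E}
    (hg : ∀ x ∈ I, HasDerivAt g (g' x) x) (hg' : ContDiffOn ℝ ∞ g' I) : ContDiffOn ℝ ∞ g I :=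
  (contDiffOn_infty_iff_deriv_of_isOpen hI).2
    ⟨fun x hx => (hg x hx).differentiableAt.differentiableWithinAt,
      hg'.congr fun x hx => (hg x hx).deriv⟩

theorem contDiffOn_integral [CompleteSpace E] {I : Set ℝ} (hI : IsOpen I) (hc : I.OrdConnected)
    {g : ℝ → E} (hg : ContDiffOn ℝ ∞ g I) {a : ℝ} (ha : a ∈ I) :
    ContDiffOn ℝ ∞ (fun t => ∫ τ in a..t, g τ) I :=
  contDiffOn_of_hasDerivAt hI
    (fun _ hb => hasDerivAt_integral_of_continuousOn hI hc hg.continuousOn ha hb) hg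

theorem hasFDerivAt_fderiv {Ω : Set E} (hΩ : IsOpen Ω) {f : E → G} (hf : ContDiffOn ℝ ∞ f Ω) {z : E}
    (hz : z ∈ Ω) : HasFDerivAt f (fderiv ℝ f z) z :=
  ((hf.contDiffAt (hΩ.mem_nhds hz)).differentiableAt (by simp)).hasFDerivAt

theorem hasFDerivAt_comp_of_hasDerivAt {g : ℝ → G} {g' : G} {u : E → ℝ} {u' : E →L[ℝ] ℝ} {z : E}
    (hg : HasDerivAt g g' (u z)) (hu : HasFDerivAt u u' z) :
    HasFDerivAt (fun z => g (u z)) (u'.smulRight g') z :=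
  (hg.hasFDerivAt.comp z hu).congr_fderiv (by ext w; simp)

theorem exists_apply_eq_of_independent {l₁ l₂ : E2 →L[ℝ] ℝ}
    (h : ∀ w, l₁ w = 0 → l₂ w = 0 → w = 0) (a b : ℝ) : ∃ w, l₁ w = a ∧ l₂ w = b := by
  have hinj : Function.Injective (l₁.prod l₂).toLinearMap :=
    (injective_iff_map_eq_zero _).2 fun w hw => h w (Prod.ext_iff.1 hw).1 (Prod.ext_iff.1 hw).2
  obtain ⟨w, hw⟩ :=
    (LinearMap.injective_iff_surjective_of_finrank_eq_finrank (by simp)).1 hinj (a, b)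
  exact ⟨w, (Prod.ext_iff.1 hw).1, (Prod.ext_iff.1 hw).2⟩

/-- Differentiating `⟪n, df b⟫ = 0` in the direction `a` turns the left-hand side into
`-⟪n, d²f a b⟫`. -/
theorem inner_fderiv_comm_of_inner_eq_zero {H : Type*} [NormedAddCommGroup H]
    [InnerProductSpace ℝ H] {f n : E → H} {z : E} (hf : ContDiffAt ℝ 2 f z)
    (hn : DifferentiableAt ℝ n z)
    (horth : ∀ᶠ x in nhds z, ∀ w, inner ℝ (n x) (fderiv ℝ f x w) = 0) (a b : E) :
    inner ℝ (fderiv ℝ n z a) (fderiv ℝ f z b) = inner ℝ (fderiv ℝ n z b) (fderiv ℝ f z a) := by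
  have hdf : HasFDerivAt (fderiv ℝ f) (fderiv ℝ (fderiv ℝ f) z) z :=
    ((hf.fderiv_right (m := 1) (by norm_num)).differentiableAt (by simp)).hasFDerivAt
  have hsymm : IsSymmSndFDerivAt ℝ f z := hf.isSymmSndFDerivAt (by simp)
  have hprod (a b : E) : inner ℝ (n z) (fderiv ℝ (fderiv ℝ f) z a b) +
      inner ℝ (fderiv ℝ n z a) (fderiv ℝ f z b) = 0 := by
    have hzero : (fun x => inner ℝ (n x) (fderiv ℝ f x b)) =ᶠ[nhds z] fun _ => (0 : ℝ) :=
      horth.mono fun x hx => hx b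
    have hderiv := (hn.hasFDerivAt.inner ℝ (hdf.clm_apply (hasFDerivAt_const b z))).unique
      ((hasFDerivAt_const (0 : ℝ) z).congr_of_eventuallyEq hzero)
    simpa using congrArg (fun l : E →L[ℝ] ℝ => l a) hderiv
  linarith [hprod a b, hprod b a, congrArg (inner ℝ (n z)) (hsymm.eq a b)]

variable {ι : Type*} [Fintype ι]

theorem hasDerivAt_euclidean {f : ℝ → EuclideanSpace ℝ ι} {f' : EuclideanSpace ℝ ι} {t : ℝ} :
    HasDerivAt f f' t ↔ ∀ i, HasDerivAt (fun s => f s i) (f' i) t := by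
  simp only [hasDerivAt_iff_hasFDerivAt, ← hasFDerivWithinAt_univ]
  rw [hasFDerivWithinAt_euclidean]
  refine forall_congr' fun i => ?_
  rw [show EuclideanSpace.proj i ∘L ContinuousLinearMap.toSpanSingleton ℝ f' =
    ContinuousLinearMap.toSpanSingleton ℝ (f' i) from by ext; simp]

theorem exists_eq_comp_proj {ε : ℝ} {g a : EuclideanSpace ℝ ι → G} (i : ι)
    (hg : ContDiffOn ℝ ∞ g (Metric.ball 0 ε))
    (hga : ∀ z ∈ Metric.ball 0 ε,
      HasFDerivAt g ((EuclideanSpace.proj i : _ →L[ℝ] ℝ).smulRight (a z)) z) :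
    ∃ Γ : ℝ → G, ContDiffOn ℝ ∞ Γ (Set.Ioo (-ε) ε) ∧
      ∀ z ∈ Metric.ball 0 ε, g z = Γ (z i) ∧ HasDerivAt Γ (a z) (z i) := by
  classical
  let axis : ℝ → EuclideanSpace ℝ ι := fun s => s • EuclideanSpace.single i 1
  have haxis_apply (s : ℝ) : axis s i = s := by simp [axis]
  have haxis_mem {s : ℝ} (hs : s ∈ Set.Ioo (-ε) ε) : axis s ∈ Metric.ball 0 ε := by
    simpa [axis, norm_smul] using abs_lt.2 hs
  have hmem {z : EuclideanSpace ℝ ι} (hz : z ∈ Metric.ball 0 ε) : z i ∈ Set.Ioo (-ε) ε :=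
    abs_lt.1 ((PiLp.norm_apply_le z i).trans_lt (mem_ball_zero_iff.1 hz))
  have hlevel {z w : EuclideanSpace ℝ ι} (hz : z ∈ Metric.ball 0 ε) (hw : w ∈ Metric.ball 0 ε)
      (hzw : z i = w i) : g z = g w := by
    have hline (t : ℝ) (ht : t ∈ Set.Icc (0 : ℝ) 1) :
        HasDerivAt (fun t => g (AffineMap.lineMap z w t)) 0 t := by
      have hmem := (convex_ball (0 : EuclideanSpace ℝ ι) ε).lineMap_mem hz hw ht
      simpa [hzw, Function.comp_def] using
        (hga _ hmem).comp_hasDerivAt t AffineMap.hasDerivAt_lineMap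
    simpa using (constant_of_has_deriv_right_zero
      (fun t ht => (hline t ht).continuousAt.continuousWithinAt)
      (fun t ht => (hline t (Set.Ico_subset_Icc_self ht)).hasDerivWithinAt) 1 (by simp)).symm
  refine ⟨fun s => g (axis s), hg.comp (by fun_prop) fun s hs => haxis_mem hs,
    fun z hz => ⟨hlevel hz (haxis_mem (hmem hz)) (haxis_apply _).symm, ?_⟩⟩
  have hline : HasDerivAt (fun s => z + axis (s - z i)) (EuclideanSpace.single i 1) (z i) := by
    simpa [axis] using
      (((hasDerivAt_id (z i)).sub_const (z i)).smul_const (EuclideanSpace.single i 1)).const_add z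
  have hz' : z + axis (z i - z i) = z := by simp [axis]
  have hderiv : HasDerivAt (fun s => g (z + axis (s - z i))) (a z) (z i) := by
    have hgz := hga z hz
    rw [← hz'] at hgz
    simpa [Function.comp_def, axis] using hgz.comp_hasDerivAt (z i) hline
  refine hderiv.congr_of_eventuallyEq ?_
  have hball : ∀ᶠ s in nhds (z i), z + axis (s - z i) ∈ Metric.ball 0 ε :=
    hline.continuousAt.eventually_mem (by simpa only [hz'] using Metric.isOpen_ball.mem_nhds hz)
  filter_upwards [hball, isOpen_Ioo.mem_nhds (hmem hz)] with s hs hsε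
  exact hlevel (haxis_mem hsε) hs (by simp [axis])

/-- `e` is a smooth chart, with smooth inverse, whose range is the ball of radius `ε` about `0`.
Balls are convex, so that maps can be recovered from their differentials in such a chart. -/
structure IsBallChart (e : OpenPartialHomeomorph E F) (ε : ℝ) : Prop where
  target_eq : e.target = Metric.ball 0 ε
  smooth : ContDiffOn ℝ ∞ e e.source
  smooth_symm : ContDiffOn ℝ ∞ e.symm e.target

theorem exists_isBallChart [CompleteSpace E] {Ω : Set E} (hΩ : IsOpen Ω) {Φ : E → F}
    (hΦ : ContDiffOn ℝ ∞ Φ Ω) {z₀ : E} (hz₀ : z₀ ∈ Ω) (hΦz₀ : Φ z₀ = 0) {L : E ≃L[ℝ] F}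
    (hL : HasFDerivAt Φ (L : E →L[ℝ] F) z₀) :
    ∃ (e : OpenPartialHomeomorph E F) (ε : ℝ), IsBallChart e ε ∧ z₀ ∈ e.source ∧ e.source ⊆ Ω ∧
      ∀ z, e z = Φ z := by
  have hat {z : E} (hz : z ∈ Ω) : ContDiffAt ℝ ∞ Φ z := hΦ.contDiffAt (hΩ.mem_nhds hz)
  have hinv : ∀ᶠ z in nhds z₀, fderiv ℝ Φ z ∈ Set.range ((↑) : (E ≃L[ℝ] F) → E →L[ℝ] F) :=
    ((hat hz₀).fderiv_right (m := 0) (by simp)).continuousAt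
      (ContinuousLinearEquiv.isOpen.mem_nhds ⟨L, hL.fderiv.symm⟩)
  obtain ⟨O, hO, hOopen, hz₀O⟩ := eventually_nhds_iff.1 hinv
  let e₀ := (hat hz₀).toOpenPartialHomeomorph Φ hL (by simp)
  let e₁ := e₀.restrOpen (Ω ∩ O) (hΩ.inter hOopen)
  have hz₀e₁ : z₀ ∈ e₁.source :=
    ⟨(hat hz₀).mem_toOpenPartialHomeomorph_source hL (by simp), hz₀, hz₀O⟩
  have h0 : (0 : F) ∈ e₁.target := hΦz₀ ▸ e₁.map_source hz₀e₁
  obtain ⟨ε, hε, hball⟩ := Metric.isOpen_iff.1 e₁.open_target 0 h0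
  let e := (e₁.symm.restrOpen (Metric.ball 0 ε) Metric.isOpen_ball).symm
  have hsource {z : E} (hz : z ∈ e.source) : z ∈ Ω ∩ O := by
    have hz₁ : z ∈ e₁.source := by simpa using hz.1
    exact hz₁.2
  refine ⟨e, ε, ⟨Set.inter_eq_right.2 hball, hΦ.mono fun z hz => (hsource hz).1,
    fun w hw => ?_⟩, ?_, fun z hz => (hsource hz).1, fun z => rfl⟩
  · obtain ⟨hΩw, hOw⟩ := hsource (e.map_target hw)
    obtain ⟨L', hL'⟩ := hO _ hOw
    refine (e.contDiffAt_symm hw (f₀' := L') ?_ (hat hΩw)).contDiffWithinAt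
    rw [hL']
    exact ((hat hΩw).differentiableAt (by simp)).hasFDerivAt
  · have hsymm : e.symm 0 = z₀ := hΦz₀ ▸ e₁.left_inv hz₀e₁
    exact hsymm ▸ e.map_target (x := 0) ⟨h0, Metric.mem_ball_self hε⟩

theorem exists_isBallChart_of_independent {Ω : Set (EuclideanSpace ℝ ι)} (hΩ : IsOpen Ω)
    {u : ι → EuclideanSpace ℝ ι → ℝ} (hu : ∀ i, ContDiffOn ℝ ∞ (u i) Ω)
    {z₀ : EuclideanSpace ℝ ι} (hz₀ : z₀ ∈ Ω) (huz₀ : ∀ i, u i z₀ = 0)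
    {l : ι → EuclideanSpace ℝ ι →L[ℝ] ℝ} (hl : ∀ i, HasFDerivAt (u i) (l i) z₀)
    (hind : ∀ w, (∀ i, l i w = 0) → w = 0) :
    ∃ (e : OpenPartialHomeomorph (EuclideanSpace ℝ ι) (EuclideanSpace ℝ ι)) (ε : ℝ),
      IsBallChart e ε ∧ z₀ ∈ e.source ∧ e.source ⊆ Ω ∧ ∀ z i, e z i = u i z := by
  let toEuclidean := (EuclideanSpace.equiv ι ℝ).symm.toContinuousLinearMap
  let D : EuclideanSpace ℝ ι →L[ℝ] EuclideanSpace ℝ ι :=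
    toEuclidean.comp (ContinuousLinearMap.pi l)
  have hD : Function.Injective D := by
    refine (injective_iff_map_eq_zero D).2 fun w hw => hind w fun i => ?_
    exact congrArg (fun v : EuclideanSpace ℝ ι => v i) hw
  let L : EuclideanSpace ℝ ι ≃L[ℝ] EuclideanSpace ℝ ι :=
    (LinearEquiv.ofInjectiveEndo D.toLinearMap hD).toContinuousLinearEquiv
  have hL : (L : EuclideanSpace ℝ ι →L[ℝ] EuclideanSpace ℝ ι) = D := by
    ext1 w
    rfl
  obtain ⟨e, ε, he, hz₀e, heΩ, heu⟩ := exists_isBallChart (L := L) hΩ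
    (Φ := fun z => WithLp.toLp 2 fun i => u i z) (contDiffOn_euclidean.2 hu) hz₀
    (by ext i; exact huz₀ i)
    (hL ▸ toEuclidean.hasFDerivAt.comp z₀ (hasFDerivAt_pi.2 hl))
  exact ⟨e, ε, he, hz₀e, heΩ, fun z i => congrArg (fun v : EuclideanSpace ℝ ι => v i) (heu z)⟩

namespace IsBallChart

section

variable {e : OpenPartialHomeomorph E (EuclideanSpace ℝ ι)} {ε : ℝ}

theorem mem_Ioo_of_mem_target (he : IsBallChart e ε) {w : EuclideanSpace ℝ ι}
    (hw : w ∈ e.target) (i : ι) : w i ∈ Set.Ioo (-ε) ε :=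
  abs_lt.1 ((PiLp.norm_apply_le w i).trans_lt (mem_ball_zero_iff.1 (he.target_eq ▸ hw)))

theorem apply_mem_Ioo (he : IsBallChart e ε) {z : E} (hz : z ∈ e.source) (i : ι) :
    e z i ∈ Set.Ioo (-ε) ε :=
  he.mem_Ioo_of_mem_target (e.map_source hz) i

theorem exists_apply_eq (he : IsBallChart e ε) (i : ι) {s : ℝ} (hs : s ∈ Set.Ioo (-ε) ε) :
    ∃ z ∈ e.source, e z i = s := by
  classical
  have hball : s • EuclideanSpace.single i (1 : ℝ) ∈ e.target := by
    rw [he.target_eq]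
    simpa [norm_smul] using abs_lt.2 hs
  exact ⟨e.symm (s • EuclideanSpace.single i 1), e.map_target hball, by simp [e.right_inv hball]⟩

theorem pos (he : IsBallChart e ε) {z : E} (hz : z ∈ e.source) : 0 < ε :=
  Metric.pos_of_mem_ball (he.target_eq ▸ e.map_source hz : e z ∈ Metric.ball 0 ε)

theorem comp_fderiv_symm (he : IsBallChart e ε) {i : ι} {l : E →L[ℝ] ℝ}
    {w : EuclideanSpace ℝ ι} (hw : w ∈ e.target)
    (hl : HasFDerivAt (fun z => e z i) l (e.symm w)) :
    l.comp (fderiv ℝ e.symm w) = EuclideanSpace.proj i := by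
  refine (hl.comp w (hasFDerivAt_fderiv e.open_target he.smooth_symm hw)).unique
    ((EuclideanSpace.proj i : _ →L[ℝ] ℝ).hasFDerivAt.congr_of_eventuallyEq ?_)
  filter_upwards [e.open_target.mem_nhds hw] with v hv
  simp [e.right_inv hv]

theorem ne_zero_of_hasFDerivAt (he : IsBallChart e ε) {i : ι} {l : E →L[ℝ] ℝ} {z : E}
    (hz : z ∈ e.source) (hl : HasFDerivAt (fun z => e z i) l z) : l ≠ 0 := by
  classical
  rintro rfl
  have h := he.comp_fderiv_symm (e.map_source hz) ((e.left_inv hz).symm ▸ hl)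
  simpa using congrArg (fun l : _ →L[ℝ] ℝ => l (EuclideanSpace.single i 1)) h

theorem exists_eq_comp (he : IsBallChart e ε) (i : ι) {l : E → E →L[ℝ] ℝ} {g a : E → G}
    (hl : ∀ z ∈ e.source, HasFDerivAt (fun z => e z i) (l z) z)
    (hg : ContDiffOn ℝ ∞ g e.source)
    (hga : ∀ z ∈ e.source, HasFDerivAt g ((l z).smulRight (a z)) z) :
    ∃ Γ : ℝ → G, ContDiffOn ℝ ∞ Γ (Set.Ioo (-ε) ε) ∧
      ∀ z ∈ e.source, g z = Γ (e z i) ∧ HasDerivAt Γ (a z) (e z i) := by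
  obtain ⟨Γ, hΓ, hgΓ⟩ := exists_eq_comp_proj (ε := ε) (g := g ∘ e.symm) (a := a ∘ e.symm) i
    (hg.comp (he.target_eq ▸ he.smooth_symm) fun w hw => e.map_target (he.target_eq ▸ hw))
    fun w hw => by
      have hw : w ∈ e.target := he.target_eq ▸ hw
      rw [← he.comp_fderiv_symm hw (hl _ (e.map_target hw))]
      exact (hga _ (e.map_target hw)).comp w (hasFDerivAt_fderiv e.open_target he.smooth_symm hw)
  refine ⟨Γ, hΓ, fun z hz => ?_⟩
  simpa [e.left_inv hz] using hgΓ (e z) (he.target_eq ▸ e.map_source hz)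

theorem exists_hasFDerivAt_of_smul (he : IsBallChart e ε) (i : ι) {l : E → E →L[ℝ] ℝ} {σ : ℝ → ℝ}
    (hσ : ContDiffOn ℝ ∞ σ (Set.Ioo (-ε) ε)) (hσ0 : ∀ z ∈ e.source, σ (e z i) ≠ 0)
    (hl : ∀ z ∈ e.source, HasFDerivAt (fun z => e z i) (σ (e z i) • l z) z) {z₀ : E}
    (hz₀ : z₀ ∈ e.source) (hez₀ : e z₀ i = 0) :
    ∃ x : E → ℝ, ContDiffOn ℝ ∞ x e.source ∧ x z₀ = 0 ∧ ∀ z ∈ e.source, HasFDerivAt x (l z) z := by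
  have h0 : (0 : ℝ) ∈ Set.Ioo (-ε) ε := ⟨neg_lt_zero.2 (he.pos hz₀), he.pos hz₀⟩
  have hinv : ContDiffOn ℝ ∞ (fun s => (σ s)⁻¹) (Set.Ioo (-ε) ε) := hσ.inv fun s hs => by
    obtain ⟨z, hz, rfl⟩ := he.exists_apply_eq i hs
    exact hσ0 z hz
  refine ⟨fun z => ∫ s in (0 : ℝ)..e z i, (σ s)⁻¹, ?_, by simp [hez₀], fun z hz => ?_⟩
  · exact (contDiffOn_integral isOpen_Ioo Set.ordConnected_Ioo hinv h0).comp
      (contDiffOn_euclidean.1 he.smooth i) fun z hz => he.apply_mem_Ioo hz i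
  · refine (hasFDerivAt_comp_of_hasDerivAt (u := fun z => e z i)
      (hasDerivAt_integral_of_continuousOn isOpen_Ioo Set.ordConnected_Ioo hinv.continuousOn h0
        (he.apply_mem_Ioo hz i)) (hl z hz)).congr_fderiv ?_
    ext1 w
    have := hσ0 z hz
    simp only [smul_apply, ContinuousLinearMap.smulRight_apply, smul_eq_mul]
    field_simp

end

theorem eq_of_hasFDerivAt_zero {e : OpenPartialHomeomorph E F} {ε : ℝ} (he : IsBallChart e ε)
    {g : E → G} (hg : ∀ z ∈ e.source, HasFDerivAt g (0 : E →L[ℝ] G) z) {z w : E}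
    (hz : z ∈ e.source) (hw : w ∈ e.source) : g z = g w := by
  have hconn : IsPreconnected e.source := by
    rw [← e.symm_image_target_eq_source, he.target_eq]
    exact (convex_ball 0 ε).isPreconnected.image _ (he.target_eq ▸ he.smooth_symm.continuousOn)
  exact e.open_source.is_const_of_fderiv_eq_zero hconn
    (fun z hz => (hg z hz).differentiableAt.differentiableWithinAt)
    (fun z hz => (hg z hz).fderiv) hz hw

end IsBallChart

end Calculus

section CylindricalFrame

variable {E : Type*} [NormedAddCommGroup E] [NormedSpace ℝ E]

/-- The horizontal unit vector in the direction of the polar angle `y`. -/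
def radialVector (y : ℝ) : E3 := !₂[Real.cos y, Real.sin y, 0]

/-- The horizontal unit vector orthogonal to `radialVector y`; it is the vector `v₀` of Case 2. -/
def parallelVector (y : ℝ) : E3 := !₂[-Real.sin y, Real.cos y, 0]

/-- The unit vector of inclination `θ` in the vertical plane of polar angle `y`. -/
def meridianVector (θ y : ℝ) : E3 := Real.cos θ • radialVector y + Real.sin θ • e3

/-- The unit vector of that vertical plane which is orthogonal to `meridianVector θ y`. It makes
the angle `θ` with the vertical direction and is the unit normal of both cases. -/
def normalVector (θ y : ℝ) : E3 := Real.cos θ • e3 - Real.sin θ • radialVector y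

theorem hasDerivAt_radialVector (y : ℝ) : HasDerivAt radialVector (parallelVector y) y := by
  rw [hasDerivAt_euclidean]
  intro i
  fin_cases i
  exacts [Real.hasDerivAt_cos y, Real.hasDerivAt_sin y, hasDerivAt_const y 0]

theorem contDiff_radialVector : ContDiff ℝ ∞ radialVector := by
  rw [contDiff_euclidean]
  intro i
  fin_cases i
  exacts [Real.contDiff_cos, Real.contDiff_sin, contDiff_const]

theorem contDiff_parallelVector : ContDiff ℝ ∞ parallelVector := by
  rw [contDiff_euclidean]
  intro i
  fin_cases i
  exacts [Real.contDiff_sin.neg, Real.contDiff_cos, contDiff_const]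

theorem orthonormal_meridian_parallel_normal (θ y : ℝ) :
    Orthonormal ℝ ![meridianVector θ y, parallelVector y, normalVector θ y] := by
  rw [orthonormal_iff_ite]
  intro i j
  fin_cases i <;> fin_cases j <;>
    simp [-inner_self_eq_norm_sq_to_K, meridianVector, parallelVector, normalVector,
      radialVector, e3, PiLp.inner_apply, Fin.sum_univ_three] <;>
    grind [Real.sin_sq_add_cos_sq θ, Real.sin_sq_add_cos_sq y]

theorem inner_meridianVector_self (θ y : ℝ) :
    inner ℝ (meridianVector θ y) (meridianVector θ y) = 1 := by
  simpa using orthonormal_iff_ite.1 (orthonormal_meridian_parallel_normal θ y) 0 0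

theorem inner_parallelVector_self (y : ℝ) : inner ℝ (parallelVector y) (parallelVector y) = 1 := by
  simpa using orthonormal_iff_ite.1 (orthonormal_meridian_parallel_normal 0 y) 1 1

theorem norm_normalVector (θ y : ℝ) : ‖normalVector θ y‖ = 1 :=
  (orthonormal_meridian_parallel_normal θ y).norm_eq_one 2

theorem inner_meridianVector_parallelVector (θ y : ℝ) :
    inner ℝ (meridianVector θ y) (parallelVector y) = 0 :=
  (orthonormal_meridian_parallel_normal θ y).inner_eq_zero (i := 0) (j := 1) (by simp)

theorem inner_normalVector_meridianVector (θ y : ℝ) :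
    inner ℝ (normalVector θ y) (meridianVector θ y) = 0 :=
  (orthonormal_meridian_parallel_normal θ y).inner_eq_zero (i := 2) (j := 0) (by simp)

theorem inner_normalVector_parallelVector (θ y : ℝ) :
    inner ℝ (normalVector θ y) (parallelVector y) = 0 :=
  (orthonormal_meridian_parallel_normal θ y).inner_eq_zero (i := 2) (j := 1) (by simp)

theorem eq_smul_meridianVector_add_smul_parallelVector {θ y : ℝ} {v : E3}
    (hv : inner ℝ (normalVector θ y) v = 0) :
    v = inner ℝ (meridianVector θ y) v • meridianVector θ y +
      inner ℝ (parallelVector y) v • parallelVector y := by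
  let b := OrthonormalBasis.mk (orthonormal_meridian_parallel_normal θ y)
    ((orthonormal_meridian_parallel_normal θ y).linearIndependent.span_eq_top_of_card_eq_finrank
      (by simp)).ge
  simpa [b, Fin.sum_univ_three, hv] using (b.sum_repr' v).symm

theorem inner_meridianVector_smul_add_smul (a b θ y : ℝ) :
    inner ℝ (meridianVector θ y) (a • meridianVector θ y + b • parallelVector y) = a := by
  rw [inner_add_right, inner_smul_right, inner_smul_right, inner_meridianVector_self,
    inner_meridianVector_parallelVector, mul_one, mul_zero, add_zero]

theorem inner_parallelVector_smul_add_smul (a b θ y : ℝ) :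
    inner ℝ (parallelVector y) (a • meridianVector θ y + b • parallelVector y) = b := by
  rw [inner_add_right, inner_smul_right, inner_smul_right, inner_parallelVector_self,
    real_inner_comm, inner_meridianVector_parallelVector, mul_one, mul_zero, zero_add]

theorem smul_meridianVector_add_smul_parallelVector_eq_zero_iff {a b θ y : ℝ} :
    a • meridianVector θ y + b • parallelVector y = 0 ↔ a = 0 ∧ b = 0 := by
  constructor
  · intro h
    exact ⟨by rw [← inner_meridianVector_smul_add_smul a b θ y, h, inner_zero_right],
      by rw [← inner_parallelVector_smul_add_smul a b θ y, h, inner_zero_right]⟩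
  · rintro ⟨rfl, rfl⟩
    simp

theorem sin_smul_meridianVector (θ y : ℝ) :
    Real.sin θ • meridianVector θ y = e3 - Real.cos θ • normalVector θ y := by
  rw [eq_sub_iff_add_eq]
  calc Real.sin θ • meridianVector θ y + Real.cos θ • normalVector θ y
      = (Real.sin θ ^ 2 + Real.cos θ ^ 2) • e3 := by
        simp only [meridianVector, normalVector]
        module
    _ = e3 := by rw [Real.sin_sq_add_cos_sq, one_smul]

theorem inner_e3_normalVector (θ y : ℝ) : inner ℝ e3 (normalVector θ y) = Real.cos θ := by
  simp [normalVector, radialVector, e3, PiLp.inner_apply, Fin.sum_univ_three]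

theorem angle_normalVector_e3 {θ : ℝ} (hθ : θ ∈ Set.Icc 0 Real.pi) (y : ℝ) :
    InnerProductGeometry.angle (normalVector θ y) e3 = θ := by
  have hnorm : ‖e3‖ = 1 := by simp [e3, EuclideanSpace.norm_eq, Fin.sum_univ_three]
  rw [InnerProductGeometry.angle, norm_normalVector, hnorm, real_inner_comm, inner_e3_normalVector,
    mul_one, div_one, Real.arccos_cos hθ.1 hθ.2]

theorem eq_normalVector {n : E3} (hn : ‖n‖ = 1) (hn0 : n 0 < 0) :
    n = normalVector (Real.arccos (n 2)) (Real.arctan (n 1 / n 0)) := by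
  have hsq : n 0 ^ 2 + n 1 ^ 2 + n 2 ^ 2 = 1 := by
    rw [← Fin.sum_univ_three fun i => n i ^ 2, ← EuclideanSpace.real_norm_sq_eq, hn, one_pow]
  have hsin : Real.sin (Real.arccos (n 2)) = -n 0 * √(1 + (n 1 / n 0) ^ 2) := by
    rw [Real.sin_arccos, ← Real.sqrt_sq (neg_nonneg.2 hn0.le), ← Real.sqrt_mul (sq_nonneg _)]
    congr 1
    rw [mul_add, ← mul_pow, neg_mul, mul_div_cancel₀ _ hn0.ne]
    linear_combination -hsq
  have hroot : √(1 + (n 1 / n 0) ^ 2) ≠ 0 := (Real.sqrt_pos.2 (by positivity)).ne'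
  ext i
  fin_cases i
  · simp [normalVector, radialVector, e3, hsin, Real.cos_arctan, hroot]
  · simp [normalVector, radialVector, e3, hsin, Real.sin_arctan]
    field_simp
    rw [mul_div_cancel_right₀ _ hn0.ne]
  · simp [normalVector, radialVector, e3, Real.cos_arccos (x := n 2) (by nlinarith) (by nlinarith)]

theorem hasFDerivAt_normalVector {θ y : E → ℝ} {θ' y' : E →L[ℝ] ℝ} {z : E}
    (hθ : HasFDerivAt θ θ' z) (hy : HasFDerivAt y y' z) :
    HasFDerivAt (fun z => normalVector (θ z) (y z))
      (-(θ'.smulRight (meridianVector (θ z) (y z))) -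
        (Real.sin (θ z) • y').smulRight (parallelVector (y z))) z := by
  refine ((hθ.cos.smul_const e3).sub (hθ.sin.smul
    (hasFDerivAt_comp_of_hasDerivAt (hasDerivAt_radialVector (y z)) hy))).congr_fderiv ?_
  ext1 w
  simp only [meridianVector, sub_apply, neg_apply, add_apply, smul_apply,
    ContinuousLinearMap.smulRight_apply, smul_eq_mul]
  module

theorem contDiffOn_normalVector {Ω : Set E} {θ y : E → ℝ} (hθ : ContDiffOn ℝ ∞ θ Ω)
    (hy : ContDiffOn ℝ ∞ y Ω) : ContDiffOn ℝ ∞ (fun z => normalVector (θ z) (y z)) Ω :=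
  (hθ.cos.smul contDiffOn_const).sub (hθ.sin.smul (contDiff_radialVector.comp_contDiffOn hy))

/-- The map `(x, y) ↦ (φ(x) cos y, φ(x) sin y, ∫₀ˣ sin θ)`, a common part of both cases. For fixed
`y` it is a curve parametrized by arc length with velocity `meridianVector (θ x) y`. -/
def profile (θ φ : ℝ → ℝ) (x y : ℝ) : E3 :=
  φ x • radialVector y + (∫ τ in (0 : ℝ)..x, Real.sin (θ τ)) • e3

/-- The horizontal curve `γ` of Case 1. -/
def planeCurve (ψ : ℝ → ℝ) (y : ℝ) : E3 :=
  !₂[-∫ τ in (0 : ℝ)..y, ψ τ * Real.sin τ, ∫ τ in (0 : ℝ)..y, ψ τ * Real.cos τ, 0]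

theorem caseOne_eq (θ φ ψ : ℝ → ℝ) (x y : ℝ) :
    caseOne θ φ ψ x y = profile θ φ x y + planeCurve ψ y := by
  ext i
  fin_cases i <;> simp [caseOne, profile, planeCurve, radialVector, e3]

theorem caseTwo_eq (θ φ : ℝ → ℝ) (y₀ x v : ℝ) :
    caseTwo θ φ y₀ x v = profile θ φ x y₀ + v • parallelVector y₀ := by
  ext i
  fin_cases i <;> simp [caseTwo, profile, parallelVector, radialVector, e3]

theorem hasDerivAt_planeCurve {J : Set ℝ} (hJ : IsIntervalAboutZero J) {ψ : ℝ → ℝ}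
    (hψ : ContinuousOn ψ J) {y : ℝ} (hy : y ∈ J) :
    HasDerivAt (planeCurve ψ) (ψ y • parallelVector y) y := by
  have hintegral {g : ℝ → ℝ} (hg : Continuous g) :
      HasDerivAt (fun s => ∫ τ in (0 : ℝ)..s, ψ τ * g τ) (ψ y * g y) y :=
    hasDerivAt_integral_of_continuousOn hJ.1 hJ.2.1 (hψ.mul hg.continuousOn) hJ.2.2 hy
  rw [hasDerivAt_euclidean]
  intro i
  fin_cases i
  · simpa [planeCurve, parallelVector] using (hintegral Real.continuous_sin).fun_neg
  · simpa [planeCurve, parallelVector] using hintegral Real.continuous_cos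
  · simpa [planeCurve, parallelVector] using hasDerivAt_const y (0 : ℝ)

theorem contDiffOn_planeCurve {J : Set ℝ} (hJ : IsIntervalAboutZero J) {ψ : ℝ → ℝ}
    (hψ : ContDiffOn ℝ ∞ ψ J) : ContDiffOn ℝ ∞ (planeCurve ψ) J :=
  contDiffOn_of_hasDerivAt hJ.1 (fun _ => hasDerivAt_planeCurve hJ hψ.continuousOn)
    (hψ.smul contDiff_parallelVector.contDiffOn)

theorem planeCurve_zero (ψ : ℝ → ℝ) : planeCurve ψ 0 = 0 := by
  ext i
  fin_cases i <;> simp [planeCurve]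

theorem exists_eq_add_planeCurve {J : Set ℝ} (hJ : IsIntervalAboutZero J) {Γ : ℝ → E3}
    (hΓ : ContDiffOn ℝ ∞ Γ J) (hΓ' : ∀ t ∈ J, ∃ s : ℝ, HasDerivAt Γ (s • parallelVector t) t) :
    ∃ ψ : ℝ → ℝ, ContDiffOn ℝ ∞ ψ J ∧
      (∀ t s, HasDerivAt Γ (s • parallelVector t) t → ψ t = s) ∧
      ∀ t ∈ J, Γ t = Γ 0 + planeCurve ψ t := by
  obtain ⟨hΓdiff, hΓderiv⟩ := (contDiffOn_infty_iff_deriv_of_isOpen hJ.1).1 hΓ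
  let ψ : ℝ → ℝ := fun t => inner ℝ (parallelVector t) (deriv Γ t)
  have hψ : ContDiffOn ℝ ∞ ψ J := contDiff_parallelVector.contDiffOn.inner ℝ hΓderiv
  have hψ_eq (t s : ℝ) (hs : HasDerivAt Γ (s • parallelVector t) t) : ψ t = s := by
    simp only [ψ, hs.deriv, inner_smul_right, inner_parallelVector_self, mul_one]
  have hψΓ (t : ℝ) (ht : t ∈ J) : HasDerivAt Γ (ψ t • parallelVector t) t := by
    obtain ⟨s, hs⟩ := hΓ' t ht
    rwa [hψ_eq t s hs]
  have hplane (t : ℝ) (ht : t ∈ J) : HasDerivAt (fun t => Γ 0 + planeCurve ψ t)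
      (ψ t • parallelVector t) t :=
    (hasDerivAt_planeCurve hJ hψ.continuousOn ht).const_add _
  exact ⟨ψ, hψ, hψ_eq, fun t ht => hJ.1.eqOn_of_deriv_eq hJ.2.1.isPreconnected hΓdiff
    (fun t ht => (hplane t ht).differentiableAt.differentiableWithinAt)
    (fun t ht => (hψΓ t ht).deriv.trans (hplane t ht).deriv.symm) hJ.2.2
    (by simp [planeCurve_zero]) ht⟩

namespace IsAngleData

variable {I : Set ℝ} {θ φ : ℝ → ℝ} {Ω : Set E} {x y : E → ℝ}

theorem hasDerivAt_integral_sin (h : IsAngleData I θ φ) {t : ℝ} (ht : t ∈ I) :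
    HasDerivAt (fun t => ∫ τ in (0 : ℝ)..t, Real.sin (θ τ)) (Real.sin (θ t)) t :=
  hasDerivAt_integral_of_continuousOn h.interval.1 h.interval.2.1 h.smooth.sin.continuousOn
    h.interval.2.2 ht

theorem contDiffOn_primitive (h : IsAngleData I θ φ) : ContDiffOn ℝ ∞ φ I :=
  contDiffOn_of_hasDerivAt h.interval.1 h.primitive h.smooth.cos

theorem contDiffOn_profile (h : IsAngleData I θ φ) (hx : ContDiffOn ℝ ∞ x Ω)
    (hy : ContDiffOn ℝ ∞ y Ω) (hxI : ∀ z ∈ Ω, x z ∈ I) :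
    ContDiffOn ℝ ∞ (fun z => profile θ φ (x z) (y z)) Ω :=
  ((h.contDiffOn_primitive.comp hx hxI).smul (contDiff_radialVector.comp_contDiffOn hy)).add
    (((contDiffOn_integral h.interval.1 h.interval.2.1 h.smooth.sin h.interval.2.2).comp
      hx hxI).smul contDiffOn_const)

theorem hasFDerivAt_profile (h : IsAngleData I θ φ) {x' y' : E →L[ℝ] ℝ} {z : E}
    (hx : HasFDerivAt x x' z) (hy : HasFDerivAt y y' z) (hxI : x z ∈ I) :
    HasFDerivAt (fun z => profile θ φ (x z) (y z))
      (x'.smulRight (meridianVector (θ (x z)) (y z)) +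
        (φ (x z) • y').smulRight (parallelVector (y z))) z := by
  refine ((((h.primitive _ hxI).comp_hasFDerivAt z hx).smul
    (hasFDerivAt_comp_of_hasDerivAt (hasDerivAt_radialVector (y z)) hy)).add
    ((hasFDerivAt_comp_of_hasDerivAt (h.hasDerivAt_integral_sin hxI) hx).smul_const
      e3)).congr_fderiv ?_
  ext1 w
  simp only [meridianVector, add_apply, smul_apply, ContinuousLinearMap.smulRight_apply,
    smul_eq_mul, Function.comp_apply]
  module

end IsAngleData

end CylindricalFrame

section PrincipalFrame

/-- Over `Ω`, the surface `f` has the orthonormal frame `meridianVector θ y`, `parallelVector y`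
with dual frame `ω₁`, `ω₂`, and the unit normal `normalVector θ y`. By `hasFDerivAt_normalVector`,
the last two conditions say that the frame is principal and that the curvature in the direction of
the first vector, which is the coefficient in `angle`, is nonzero. -/
structure IsPrincipalFrame (Ω : Set E2) (f : E2 → E3) (θ y : E2 → ℝ) (ω₁ ω₂ : E2 → E2 →L[ℝ] ℝ) :
    Prop where
  isOpen : IsOpen Ω
  smooth : ContDiffOn ℝ ∞ f Ω
  smooth_angle : ContDiffOn ℝ ∞ θ Ω
  smooth_polarAngle : ContDiffOn ℝ ∞ y Ω
  mem_Ioo : ∀ z ∈ Ω, θ z ∈ Set.Ioo 0 Real.pi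
  hasFDerivAt : ∀ z ∈ Ω, HasFDerivAt f
    ((ω₁ z).smulRight (meridianVector (θ z) (y z)) + (ω₂ z).smulRight (parallelVector (y z))) z
  independent : ∀ z ∈ Ω, ∀ w, ω₁ z w = 0 → ω₂ z w = 0 → w = 0
  angle : ∀ z ∈ Ω, ∃ c : ℝ, c ≠ 0 ∧ HasFDerivAt θ (c • ω₁ z) z
  polarAngle : ∀ z ∈ Ω, ∃ c : ℝ, HasFDerivAt y (c • ω₂ z) z

/-- Over `Ω`, the surface `g` has the unit normal `n`, and the tangent part of `k` is a canonical
principal direction. -/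
structure IsCanonicalPatch (k : E3) (g n : E2 → E3) (Ω : Set E2) : Prop where
  isOpen : IsOpen Ω
  smooth : ContDiffOn ℝ ∞ g Ω
  smooth_normal : ContDiffOn ℝ ∞ n Ω
  injective : ∀ z ∈ Ω, Function.Injective (fderiv ℝ g z)
  norm_eq_one : ∀ z ∈ Ω, ‖n z‖ = 1
  orthogonal : ∀ z ∈ Ω, ∀ w, inner ℝ (n z) (fderiv ℝ g z w) = 0
  principal : ∀ z ∈ Ω, ∃ (w : E2) (c : ℝ), w ≠ 0 ∧ c ≠ 0 ∧
    fderiv ℝ g z w = k - inner ℝ k (n z) • n z ∧ fderiv ℝ n z w = -(c • fderiv ℝ g z w)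

namespace IsPrincipalFrame

variable {Ω : Set E2} {f n : E2 → E3} {θ y : E2 → ℝ} {ω₁ ω₂ : E2 → E2 →L[ℝ] ℝ} {z : E2}

theorem mono (h : IsPrincipalFrame Ω f θ y ω₁ ω₂) {Ω' : Set E2} (hΩ' : IsOpen Ω')
    (hsub : Ω' ⊆ Ω) : IsPrincipalFrame Ω' f θ y ω₁ ω₂ where
  isOpen := hΩ'
  smooth := h.smooth.mono hsub
  smooth_angle := h.smooth_angle.mono hsub
  smooth_polarAngle := h.smooth_polarAngle.mono hsub
  mem_Ioo z hz := h.mem_Ioo z (hsub hz)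
  hasFDerivAt z hz := h.hasFDerivAt z (hsub hz)
  independent z hz := h.independent z (hsub hz)
  angle z hz := h.angle z (hsub hz)
  polarAngle z hz := h.polarAngle z (hsub hz)

theorem sin_pos (h : IsPrincipalFrame Ω f θ y ω₁ ω₂) (hz : z ∈ Ω) : 0 < Real.sin (θ z) :=
  Real.sin_pos_of_mem_Ioo (h.mem_Ioo z hz)

theorem fderiv_apply (h : IsPrincipalFrame Ω f θ y ω₁ ω₂) (hz : z ∈ Ω) (w : E2) :
    fderiv ℝ f z w =
      ω₁ z w • meridianVector (θ z) (y z) + ω₂ z w • parallelVector (y z) := by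
  rw [(h.hasFDerivAt z hz).fderiv]
  rfl

theorem hasFDerivAt_inner_e3 (h : IsPrincipalFrame Ω f θ y ω₁ ω₂) (hz : z ∈ Ω) :
    HasFDerivAt (fun z => inner ℝ e3 (f z)) (Real.sin (θ z) • ω₁ z) z := by
  refine ((innerSL ℝ e3).hasFDerivAt.comp z (h.hasFDerivAt z hz)).congr_fderiv ?_
  ext1 w
  simp [-inner_self_eq_norm_sq_to_K, inner_add_right, inner_smul_right, meridianVector,
    radialVector, parallelVector, e3, PiLp.inner_apply, Fin.sum_univ_three, mul_comm]

theorem fderiv_normalVector_eq_zero_iff (h : IsPrincipalFrame Ω f θ y ω₁ ω₂) (hz : z ∈ Ω) :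
    (∃ w ≠ 0, fderiv ℝ (fun z => normalVector (θ z) (y z)) z w = 0) ↔ fderiv ℝ y z = 0 := by
  obtain ⟨c, hc, hθ⟩ := h.angle z hz
  obtain ⟨d, hy⟩ := h.polarAngle z hz
  have hdn (w : E2) : fderiv ℝ (fun z => normalVector (θ z) (y z)) z w =
      (-(c * ω₁ z w)) • meridianVector (θ z) (y z) +
        (-(Real.sin (θ z) * (d * ω₂ z w))) • parallelVector (y z) := by
    rw [(hasFDerivAt_normalVector hθ hy).fderiv]
    simp only [sub_apply, neg_apply, smul_apply, ContinuousLinearMap.smulRight_apply, smul_eq_mul]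
    module
  rw [hy.fderiv]
  constructor
  · rintro ⟨w, hw0, hw⟩
    rw [hdn, smul_meridianVector_add_smul_parallelVector_eq_zero_iff, neg_eq_zero, neg_eq_zero,
      mul_eq_zero_iff_left hc, mul_eq_zero_iff_left (h.sin_pos hz).ne'] at hw
    have hω₂ : ω₂ z w ≠ 0 := fun hw₂ => hw0 (h.independent z hz w hw.1 hw₂)
    rw [(mul_eq_zero_iff_right hω₂).1 hw.2, zero_smul]
  · intro hd
    obtain ⟨w, hw₁, hw₂⟩ := exists_apply_eq_of_independent (h.independent z hz) 0 1
    refine ⟨w, ?_, ?_⟩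
    · rintro rfl
      simp at hw₂
    · have hdw : d * ω₂ z w = 0 := congrArg (fun l : E2 →L[ℝ] ℝ => l w) hd
      rw [hdn, hw₁, hdw]
      simp

theorem isCanonicalPatch (h : IsPrincipalFrame Ω f θ y ω₁ ω₂) :
    IsCanonicalPatch e3 f (fun z => normalVector (θ z) (y z)) Ω where
  isOpen := h.isOpen
  smooth := h.smooth
  smooth_normal := contDiffOn_normalVector h.smooth_angle h.smooth_polarAngle
  injective z hz := (injective_iff_map_eq_zero _).2 fun w hw => by
    rw [h.fderiv_apply hz] at hw
    refine h.independent z hz w ?_ ?_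
    · rw [← inner_meridianVector_smul_add_smul (ω₁ z w) (ω₂ z w) (θ z) (y z), hw, inner_zero_right]
    · rw [← inner_parallelVector_smul_add_smul (ω₁ z w) (ω₂ z w) (θ z) (y z), hw, inner_zero_right]
  norm_eq_one z _ := norm_normalVector _ _
  orthogonal z hz w := by
    simp [h.fderiv_apply hz, inner_add_right, inner_smul_right,
      inner_normalVector_meridianVector, inner_normalVector_parallelVector]
  principal z hz := by
    obtain ⟨c, hc, hθ⟩ := h.angle z hz
    obtain ⟨d, hy⟩ := h.polarAngle z hz
    obtain ⟨w, hw₁, hw₂⟩ :=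
      exists_apply_eq_of_independent (h.independent z hz) (Real.sin (θ z)) 0
    refine ⟨w, c, ?_, hc, ?_, ?_⟩
    · rintro rfl
      exact (h.sin_pos hz).ne (by simpa using hw₁)
    · simp [h.fderiv_apply hz, hw₁, hw₂, sin_smul_meridianVector, inner_e3_normalVector]
    · simp [(hasFDerivAt_normalVector hθ hy).fderiv, h.fderiv_apply hz, hw₁, hw₂, mul_smul]

end IsPrincipalFrame

theorem exists_eq_normalVector {Ω : Set E2} {n : E2 → E3} (hn : ContDiffOn ℝ ∞ n Ω)
    (hnorm : ∀ z ∈ Ω, ‖n z‖ = 1) (hneg : ∀ z ∈ Ω, n z 0 < 0) :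
    ∃ θ y : E2 → ℝ, ContDiffOn ℝ ∞ θ Ω ∧ ContDiffOn ℝ ∞ y Ω ∧
      (∀ z ∈ Ω, θ z ∈ Set.Ioo 0 Real.pi) ∧ (∀ z, n z 1 = 0 → y z = 0) ∧
      ∀ z ∈ Ω, n z = normalVector (θ z) (y z) := by
  have hcoord := contDiffOn_euclidean.1 hn
  have hsq (z : E2) (hz : z ∈ Ω) : n z 0 ^ 2 + n z 1 ^ 2 + n z 2 ^ 2 = 1 := by
    rw [← Fin.sum_univ_three fun i => n z i ^ 2, ← EuclideanSpace.real_norm_sq_eq, hnorm z hz,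
      one_pow]
  have hlt (z : E2) (hz : z ∈ Ω) : n z 2 ∈ Set.Ioo (-1) 1 := by
    rw [Set.mem_Ioo, ← abs_lt, ← sq_lt_one_iff_abs_lt_one]
    nlinarith [hsq z hz, hneg z hz, sq_nonneg (n z 1)]
  refine ⟨fun z => Real.arccos (n z 2), fun z => Real.arctan (n z 1 / n z 0), ?_, ?_, ?_, ?_,
    fun z hz => eq_normalVector (hnorm z hz) (hneg z hz)⟩
  · have harccos : ContDiffOn ℝ ∞ Real.arccos (Set.Ioo (-1) 1) := fun t ht =>
      (Real.contDiffAt_arccos ht.1.ne' ht.2.ne).contDiffWithinAt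
    exact harccos.comp (hcoord 2) hlt
  · exact Real.contDiff_arctan.comp_contDiffOn
      ((hcoord 1).div (hcoord 0) fun z hz => (hneg z hz).ne)
  · exact fun z hz => ⟨Real.arccos_pos.2 (hlt z hz).2,
      (Real.arccos_le_pi _).lt_of_ne fun h => (hlt z hz).1.not_ge (Real.arccos_eq_pi.1 h)⟩
  · intro z hz
    simp [hz]

namespace IsCanonicalPatch

variable {Ω : Set E2} {g n : E2 → E3} {θ y : E2 → ℝ} {z : E2}

theorem fderiv_apply (h : IsCanonicalPatch e3 g n Ω)
    (hn : ∀ z ∈ Ω, n z = normalVector (θ z) (y z)) (hz : z ∈ Ω) (w : E2) :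
    fderiv ℝ g z w =
      inner ℝ (meridianVector (θ z) (y z)) (fderiv ℝ g z w) • meridianVector (θ z) (y z) +
        inner ℝ (parallelVector (y z)) (fderiv ℝ g z w) • parallelVector (y z) :=
  eq_smul_meridianVector_add_smul_parallelVector (hn z hz ▸ h.orthogonal z hz w)

theorem fderiv_normal_apply (h : IsCanonicalPatch e3 g n Ω) (hθ : ContDiffOn ℝ ∞ θ Ω)
    (hy : ContDiffOn ℝ ∞ y Ω) (hn : ∀ z ∈ Ω, n z = normalVector (θ z) (y z)) (hz : z ∈ Ω)
    (w : E2) :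
    fderiv ℝ n z w = (-fderiv ℝ θ z w) • meridianVector (θ z) (y z) +
      (-(Real.sin (θ z) * fderiv ℝ y z w)) • parallelVector (y z) := by
  rw [Filter.EventuallyEq.fderiv_eq (Filter.mem_of_superset (h.isOpen.mem_nhds hz) hn),
    (hasFDerivAt_normalVector (hasFDerivAt_fderiv h.isOpen hθ hz)
      (hasFDerivAt_fderiv h.isOpen hy hz)).fderiv]
  simp only [sub_apply, neg_apply, smul_apply, ContinuousLinearMap.smulRight_apply, smul_eq_mul]
  module

theorem fderiv_angle_mul_add_comm (h : IsCanonicalPatch e3 g n Ω) (hθ : ContDiffOn ℝ ∞ θ Ω)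
    (hy : ContDiffOn ℝ ∞ y Ω) (hn : ∀ z ∈ Ω, n z = normalVector (θ z) (y z)) (hz : z ∈ Ω)
    (a b : E2) :
    fderiv ℝ θ z a * inner ℝ (meridianVector (θ z) (y z)) (fderiv ℝ g z b) +
        Real.sin (θ z) * fderiv ℝ y z a * inner ℝ (parallelVector (y z)) (fderiv ℝ g z b) =
      fderiv ℝ θ z b * inner ℝ (meridianVector (θ z) (y z)) (fderiv ℝ g z a) +
        Real.sin (θ z) * fderiv ℝ y z b * inner ℝ (parallelVector (y z)) (fderiv ℝ g z a) := by
  have hsymm := inner_fderiv_comm_of_inner_eq_zero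
    ((h.smooth.contDiffAt (h.isOpen.mem_nhds hz)).of_le (by norm_cast))
    ((h.smooth_normal.contDiffAt (h.isOpen.mem_nhds hz)).differentiableAt (by simp))
    (Filter.mem_of_superset (h.isOpen.mem_nhds hz) h.orthogonal) a b
  simp only [h.fderiv_normal_apply hθ hy hn hz, inner_add_left, inner_smul_left, map_neg, map_mul,
    conj_trivial] at hsymm
  linarith

theorem exists_fderiv_angle (h : IsCanonicalPatch e3 g n Ω) (hθ : ContDiffOn ℝ ∞ θ Ω)
    (hy : ContDiffOn ℝ ∞ y Ω) (hn : ∀ z ∈ Ω, n z = normalVector (θ z) (y z)) (hz : z ∈ Ω)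
    (hsin : Real.sin (θ z) ≠ 0) :
    ∃ (u : E2) (c : ℝ), c ≠ 0 ∧
      fderiv ℝ g z u = Real.sin (θ z) • meridianVector (θ z) (y z) ∧
      fderiv ℝ θ z u = c * Real.sin (θ z) ∧ fderiv ℝ y z u = 0 := by
  obtain ⟨u, c, -, hc, hu, hnu⟩ := h.principal z hz
  rw [hn z hz, inner_e3_normalVector, ← sin_smul_meridianVector] at hu
  rw [h.fderiv_normal_apply hθ hy hn hz, hu, ← sub_eq_zero] at hnu
  have hcoeff : (c * Real.sin (θ z) - fderiv ℝ θ z u) • meridianVector (θ z) (y z) +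
      (-(Real.sin (θ z) * fderiv ℝ y z u)) • parallelVector (y z) = 0 := by
    rw [← hnu]
    module
  rw [smul_meridianVector_add_smul_parallelVector_eq_zero_iff, neg_eq_zero,
    mul_eq_zero_iff_left hsin] at hcoeff
  exact ⟨u, c, hc, hu, by linarith [hcoeff.1], hcoeff.2⟩

/-- Symmetry of the second fundamental form, applied to the principal direction, says that `dθ`
vanishes on the parallels; applied to the parallels, it then says that `dy` vanishes on the
meridians. -/
theorem isPrincipalFrame (h : IsCanonicalPatch e3 g n Ω) (hθ : ContDiffOn ℝ ∞ θ Ω)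
    (hy : ContDiffOn ℝ ∞ y Ω) (hmem : ∀ z ∈ Ω, θ z ∈ Set.Ioo 0 Real.pi)
    (hn : ∀ z ∈ Ω, n z = normalVector (θ z) (y z)) :
    IsPrincipalFrame Ω g θ y
      (fun z => (innerSL ℝ (meridianVector (θ z) (y z))).comp (fderiv ℝ g z))
      (fun z => (innerSL ℝ (parallelVector (y z))).comp (fderiv ℝ g z)) := by
  have hsin {z : E2} (hz : z ∈ Ω) : Real.sin (θ z) ≠ 0 := (Real.sin_pos_of_mem_Ioo (hmem z hz)).ne'
  have hind {z : E2} (hz : z ∈ Ω) (w : E2)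
      (hw₁ : inner ℝ (meridianVector (θ z) (y z)) (fderiv ℝ g z w) = 0)
      (hw₂ : inner ℝ (parallelVector (y z)) (fderiv ℝ g z w) = 0) : w = 0 := by
    refine h.injective z hz ?_
    rw [map_zero, h.fderiv_apply hn hz, hw₁, hw₂, zero_smul, zero_smul, add_zero]
  have hangle {z : E2} (hz : z ∈ Ω) : ∃ c : ℝ, c ≠ 0 ∧ ∀ b, fderiv ℝ θ z b =
      c * inner ℝ (meridianVector (θ z) (y z)) (fderiv ℝ g z b) := by
    obtain ⟨u, c, hc, hgu, hθu, hyu⟩ := h.exists_fderiv_angle hθ hy hn hz (hsin hz)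
    refine ⟨c, hc, fun b => mul_right_cancel₀ (hsin hz) ?_⟩
    have hsymm := h.fderiv_angle_mul_add_comm hθ hy hn hz u b
    rw [hgu, inner_smul_right, inner_smul_right, inner_meridianVector_self,
      real_inner_comm (meridianVector (θ z) (y z)), inner_meridianVector_parallelVector, hθu,
      hyu] at hsymm
    linarith
  refine ⟨h.isOpen, h.smooth, hθ, hy, hmem, fun z hz =>
    (hasFDerivAt_fderiv h.isOpen h.smooth hz).congr_fderiv (by
      ext1 w; exact h.fderiv_apply hn hz w),
    fun z hz => hind hz, fun z hz => ?_, fun z hz => ?_⟩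
  · obtain ⟨c, hc, hc'⟩ := hangle hz
    exact ⟨c, hc, (hasFDerivAt_fderiv h.isOpen hθ hz).congr_fderiv (by ext1 b; exact hc' b)⟩
  · obtain ⟨c, -, hc⟩ := hangle hz
    obtain ⟨b, hb₁, hb₂⟩ := exists_apply_eq_of_independent
      (l₁ := (innerSL ℝ (meridianVector (θ z) (y z))).comp (fderiv ℝ g z))
      (l₂ := (innerSL ℝ (parallelVector (y z))).comp (fderiv ℝ g z)) (hind hz) 0 1
    simp only [ContinuousLinearMap.comp_apply, innerSL_apply_apply] at hb₁ hb₂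
    refine ⟨fderiv ℝ y z b, (hasFDerivAt_fderiv h.isOpen hy hz).congr_fderiv ?_⟩
    ext1 a
    refine mul_left_cancel₀ (hsin hz) ?_
    have hsymm := h.fderiv_angle_mul_add_comm hθ hy hn hz a b
    rw [hc b, hb₁, hb₂] at hsymm
    simp only [smul_apply, ContinuousLinearMap.comp_apply, innerSL_apply_apply, smul_eq_mul]
    linarith

end IsCanonicalPatch

end PrincipalFrame

section Coordinates

theorem isIntervalAboutZero_Ioo {ε : ℝ} (hε : 0 < ε) : IsIntervalAboutZero (Set.Ioo (-ε) ε) :=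
  ⟨isOpen_Ioo, Set.ordConnected_Ioo, neg_lt_zero.2 hε, hε⟩

theorem IsBallChart.mem_maximalAtlas {e : OpenPartialHomeomorph E2 E2} {ε : ℝ}
    (he : IsBallChart e ε) : e ∈ IsManifold.maximalAtlas (𝓡 2) ∞ E2 :=
  (IsManifold.mem_maximalAtlas_iff_contMDiffOn e).2
    ⟨contMDiffOn_iff_contDiffOn.2 he.smooth, contMDiffOn_iff_contDiffOn.2 he.smooth_symm⟩

namespace IsPrincipalFrame

variable {Ω : Set E2} {f n : E2 → E3} {θ y : E2 → ℝ} {ω₁ ω₂ : E2 → E2 →L[ℝ] ℝ} {z₀ : E2}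

/-- The height has the differential `sin θ • ω₁`, so `θ` is locally a function of the height, and
the arc length of the meridians is obtained by integrating `1 / sin θ` over the height. -/
theorem exists_arclength (h : IsPrincipalFrame Ω f θ y ω₁ ω₂) (hz₀ : z₀ ∈ Ω) :
    ∃ (Ω' : Set E2) (x : E2 → ℝ), IsOpen Ω' ∧ z₀ ∈ Ω' ∧ Ω' ⊆ Ω ∧ ContDiffOn ℝ ∞ x Ω' ∧ x z₀ = 0 ∧
      ∀ z ∈ Ω', HasFDerivAt x (ω₁ z) z := by
  let height : E2 → ℝ := fun z => inner ℝ e3 (f z) - inner ℝ e3 (f z₀)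
  have hheight (z : E2) (hz : z ∈ Ω) : HasFDerivAt height (Real.sin (θ z) • ω₁ z) z :=
    (h.hasFDerivAt_inner_e3 hz).sub_const _
  obtain ⟨e, ε, he, hz₀e, hsub, heq⟩ := exists_isBallChart_of_independent h.isOpen
    (u := ![height, fun z => ω₂ z₀ (z - z₀)]) (l := ![Real.sin (θ z₀) • ω₁ z₀, ω₂ z₀])
    (Fin.forall_fin_two.2 ⟨(contDiffOn_const.inner ℝ h.smooth).sub contDiffOn_const,
      ((ω₂ z₀).contDiff.comp (contDiff_id.sub contDiff_const)).contDiffOn⟩) hz₀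
    (Fin.forall_fin_two.2 ⟨sub_self _, by simp⟩)
    (Fin.forall_fin_two.2 ⟨hheight z₀ hz₀,
      (ω₂ z₀).hasFDerivAt.comp z₀ ((hasFDerivAt_id z₀).sub_const z₀)⟩)
    (fun w hw => h.independent z₀ hz₀ w
      ((mul_eq_zero_iff_left (h.sin_pos hz₀).ne').1 (hw 0)) (hw 1))
  have he₀ : (fun z => e z 0) = height := funext fun z => heq z 0
  have hde₀ (z : E2) (hz : z ∈ e.source) :
      HasFDerivAt (fun z => e z 0) (Real.sin (θ z) • ω₁ z) z := he₀ ▸ hheight z (hsub hz)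
  choose! c _ hc using h.angle
  obtain ⟨Θ, hΘ, hθΘ⟩ := he.exists_eq_comp 0 hde₀ (h.smooth_angle.mono hsub)
    (a := fun z => c z / Real.sin (θ z)) fun z hz => (hc z (hsub hz)).congr_fderiv (by
      ext1 w
      have := (h.sin_pos (hsub hz)).ne'
      simp only [smul_apply, ContinuousLinearMap.smulRight_apply, smul_eq_mul]
      field_simp)
  obtain ⟨x, hx, hxz₀, hdx⟩ := he.exists_hasFDerivAt_of_smul 0 hΘ.sin
    (fun z hz => (hθΘ z hz).1 ▸ (h.sin_pos (hsub hz)).ne')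
    (fun z hz => (hθΘ z hz).1 ▸ hde₀ z hz) hz₀e (by simp [heq, height])
  exact ⟨e.source, x, e.open_source, hz₀e, hsub, hx, hxz₀, hdx⟩

variable {e : OpenPartialHomeomorph E2 E2} {ε : ℝ}

theorem exists_isAngleData (h : IsPrincipalFrame Ω f θ y ω₁ ω₂) (he : IsBallChart e ε)
    (hz₀ : z₀ ∈ e.source) (hsub : e.source ⊆ Ω)
    (hx : ∀ z ∈ e.source, HasFDerivAt (fun z => e z 0) (ω₁ z) z) :
    ∃ Θ : ℝ → ℝ, IsAngleData (Set.Ioo (-ε) ε) Θ (fun t => ∫ τ in (0 : ℝ)..t, Real.cos (Θ τ)) ∧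
      ∀ z ∈ e.source, θ z = Θ (e z 0) := by
  choose! c hc0 hc using h.angle
  obtain ⟨Θ, hΘ, hθΘ⟩ := he.exists_eq_comp 0 hx (h.smooth_angle.mono hsub) (a := c)
    fun z hz => (hc z (hsub hz)).congr_fderiv (by
      ext1 w
      simp only [smul_apply, ContinuousLinearMap.smulRight_apply, smul_eq_mul, mul_comm])
  have hI := isIntervalAboutZero_Ioo (he.pos hz₀)
  refine ⟨Θ, ⟨hI, hΘ, fun s hs => ?_, fun s hs => ?_, fun s hs =>
    hasDerivAt_integral_of_continuousOn hI.1 hI.2.1 hΘ.cos.continuousOn hI.2.2 hs⟩,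
    fun z hz => (hθΘ z hz).1⟩
  · obtain ⟨z, hz, rfl⟩ := he.exists_apply_eq 0 hs
    exact (hθΘ z hz).1 ▸ h.mem_Ioo z (hsub hz)
  · obtain ⟨z, hz, rfl⟩ := he.exists_apply_eq 0 hs
    exact (hθΘ z hz).2.deriv.symm ▸ hc0 z (hsub hz)

theorem hasAngle (h : IsPrincipalFrame Ω f θ y ω₁ ω₂)
    (hn : ∀ z ∈ Ω, n z = normalVector (θ z) (y z)) (hsub : e.source ⊆ Ω) {Θ : ℝ → ℝ}
    (hΘ : ∀ z ∈ e.source, θ z = Θ (e z 0)) : HasAngle n e3 e Θ := fun z hz => by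
  rw [hn z (hsub hz), angle_normalVector_e3 (Set.Ioo_subset_Icc_self (h.mem_Ioo z (hsub hz))),
    hΘ z hz]

theorem exists_eq_profile_add_planeCurve (h : IsPrincipalFrame Ω f θ y ω₁ ω₂)
    (he : IsBallChart e ε) (hz₀ : z₀ ∈ e.source) (hsub : e.source ⊆ Ω)
    (hx : ∀ z ∈ e.source, HasFDerivAt (fun z => e z 0) (ω₁ z) z)
    (hy : ∀ z ∈ e.source, e z 1 = y z) {Θ φ : ℝ → ℝ} (hΘ : IsAngleData (Set.Ioo (-ε) ε) Θ φ)
    (hθΘ : ∀ z ∈ e.source, θ z = Θ (e z 0)) :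
    ∃ (C : E3) (ψ : ℝ → ℝ), ContDiffOn ℝ ∞ ψ (Set.Ioo (-ε) ε) ∧
      ∀ z ∈ e.source, φ (e z 0) + ψ (e z 1) ≠ 0 ∧
        f z = C + (profile Θ φ (e z 0) (e z 1) + planeCurve ψ (e z 1)) := by
  choose! c hc using h.polarAngle
  have hdy (z : E2) (hz : z ∈ e.source) : HasFDerivAt (fun z => e z 1) (c z • ω₂ z) z :=
    (hc z (hsub hz)).congr_of_eventuallyEq
      (Filter.mem_of_superset (e.open_source.mem_nhds hz) hy)
  have hc0 (z : E2) (hz : z ∈ e.source) : c z ≠ 0 := fun hcz =>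
    he.ne_zero_of_hasFDerivAt hz (hdy z hz) (by rw [hcz, zero_smul])
  have hcoord := contDiffOn_euclidean.1 he.smooth
  obtain ⟨Γ, hΓ, hfΓ⟩ := he.exists_eq_comp 1
    (g := fun z => f z - profile Θ φ (e z 0) (e z 1))
    (a := fun z => ((c z)⁻¹ - φ (e z 0)) • parallelVector (e z 1)) hdy
    ((h.smooth.mono hsub).sub (hΘ.contDiffOn_profile (hcoord 0) (hcoord 1)
      fun z hz => he.apply_mem_Ioo hz 0))
    fun z hz => ((h.hasFDerivAt z (hsub hz)).sub (hΘ.hasFDerivAt_profile (hx z hz) (hdy z hz)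
      (he.apply_mem_Ioo hz 0))).congr_fderiv (by
        have := hc0 z hz
        ext1 w
        simp only [sub_apply, add_apply, smul_apply, ContinuousLinearMap.smulRight_apply,
          ← hθΘ z hz, hy z hz, smul_eq_mul]
        match_scalars <;> field_simp
        ring)
  obtain ⟨ψ, hψ, hψΓ, hΓψ⟩ := exists_eq_add_planeCurve (isIntervalAboutZero_Ioo (he.pos hz₀)) hΓ
    fun t ht => by
      obtain ⟨z, hz, rfl⟩ := he.exists_apply_eq 1 ht
      exact ⟨_, (hfΓ z hz).2⟩
  refine ⟨Γ 0, ψ, hψ, fun z hz => ⟨?_, ?_⟩⟩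
  · simpa [hψΓ _ _ (hfΓ z hz).2] using hc0 z hz
  · rw [sub_eq_iff_eq_add'.1 ((hfΓ z hz).1.trans (hΓψ _ (he.apply_mem_Ioo hz 1))),
      add_left_comm]

theorem isCaseOneNear (h : IsPrincipalFrame Ω f θ y ω₁ ω₂)
    (hn : ∀ z ∈ Ω, n z = normalVector (θ z) (y z)) (hz₀ : z₀ ∈ Ω) (hyz₀ : y z₀ = 0)
    (hdy : fderiv ℝ y z₀ ≠ 0) : IsCaseOneNear f n e3 z₀ := by
  obtain ⟨Ω', x, hΩ', hz₀', hsub', hx, hxz₀, hdx⟩ := h.exists_arclength hz₀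
  obtain ⟨c, hc⟩ := h.polarAngle z₀ hz₀
  have hc0 : c ≠ 0 := by
    rintro rfl
    exact hdy (by rw [hc.fderiv, zero_smul])
  obtain ⟨e, ε, he, hz₀e, hsub, heq⟩ := exists_isBallChart_of_independent hΩ'
    (u := ![x, y]) (l := ![ω₁ z₀, c • ω₂ z₀])
    (Fin.forall_fin_two.2 ⟨hx, h.smooth_polarAngle.mono hsub'⟩) hz₀'
    (Fin.forall_fin_two.2 ⟨hxz₀, hyz₀⟩) (Fin.forall_fin_two.2 ⟨hdx z₀ hz₀', hc⟩)
    (fun w hw => h.independent z₀ hz₀ w (hw 0) ((mul_eq_zero_iff_left hc0).1 (hw 1)))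
  have hsubΩ := hsub.trans hsub'
  have hde₀ (z : E2) (hz : z ∈ e.source) : HasFDerivAt (fun z => e z 0) (ω₁ z) z :=
    (funext fun z => heq z 0 : (fun z => e z 0) = x) ▸ hdx z (hsub hz)
  obtain ⟨Θ, hΘ, hθΘ⟩ := h.exists_isAngleData he hz₀e hsubΩ hde₀
  obtain ⟨C, ψ, hψ, hfψ⟩ := h.exists_eq_profile_add_planeCurve he hz₀e hsubΩ hde₀
    (fun z _ => heq z 1) hΘ hθΘ
  refine ⟨e, Θ, _, ψ, _, _, hz₀e, ⟨he.mem_maximalAtlas, fun w hw =>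
    ⟨he.mem_Ioo_of_mem_target hw 0, he.mem_Ioo_of_mem_target hw 1⟩, hΘ, hΘ.interval, hψ,
    fun w hw => ?_, AffineIsometryEquiv.constVAdd ℝ E3 (-C), ?_, fun z hz => ?_⟩,
    h.hasAngle hn hsubΩ hθΘ⟩
  · simpa [e.right_inv hw] using (hfψ _ (e.map_target hw)).1
  · rfl
  · simp [caseOne_eq, (hfψ z hz).2]

theorem exists_eq_profile_add_smul_parallelVector (h : IsPrincipalFrame Ω f θ y ω₁ ω₂)
    (he : IsBallChart e ε) (hz₀ : z₀ ∈ e.source) (hsub : e.source ⊆ Ω) {y₀ : ℝ}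
    (hy : ∀ z ∈ e.source, y z = y₀)
    (hx : ∀ z ∈ e.source, HasFDerivAt (fun z => e z 0) (ω₁ z) z)
    (hv : ∀ z ∈ e.source, HasFDerivAt (fun z => e z 1) (ω₂ z) z) {Θ φ : ℝ → ℝ}
    (hΘ : IsAngleData (Set.Ioo (-ε) ε) Θ φ) (hθΘ : ∀ z ∈ e.source, θ z = Θ (e z 0)) :
    ∃ C : E3, ∀ z ∈ e.source,
      f z = C + (profile Θ φ (e z 0) y₀ + e z 1 • parallelVector y₀) := by
  have hzero (z : E2) (hz : z ∈ e.source) :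
      HasFDerivAt (fun z => f z - (profile Θ φ (e z 0) y₀ + e z 1 • parallelVector y₀))
        (0 : E2 →L[ℝ] E3) z :=
    ((h.hasFDerivAt z (hsub hz)).sub ((hΘ.hasFDerivAt_profile (hx z hz) (hasFDerivAt_const y₀ z)
      (he.apply_mem_Ioo hz 0)).add ((hv z hz).smul_const _))).congr_fderiv (by
        simp [hy z hz, hθΘ z hz])
  exact ⟨_, fun z hz => sub_eq_iff_eq_add.1 (he.eq_of_hasFDerivAt_zero hzero hz hz₀)⟩

/-- As `y` is constant near `z₀`, the parallels are pieces of lines in the direction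
`parallelVector (y z₀)`, and arc length along these lines is the second coordinate. -/
theorem isCaseTwoNear (h : IsPrincipalFrame Ω f θ y ω₁ ω₂)
    (hn : ∀ z ∈ Ω, n z = normalVector (θ z) (y z)) (hz₀ : z₀ ∈ Ω)
    (hdy : ∀ z ∈ Ω, fderiv ℝ y z = 0) : IsCaseTwoNear f n e3 z₀ := by
  obtain ⟨Ω', x, hΩ', hz₀', hsub', hx, hxz₀, hdx⟩ := h.exists_arclength hz₀
  let v : E2 → ℝ := fun z => inner ℝ (parallelVector (y z₀)) (f z - f z₀)
  have hdv {z : E2} (hz : z ∈ Ω) (hyz : y z = y z₀) : HasFDerivAt v (ω₂ z) z := by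
    refine ((innerSL ℝ (parallelVector (y z₀))).hasFDerivAt.comp z
      ((h.hasFDerivAt z hz).sub_const (f z₀))).congr_fderiv ?_
    ext1 w
    rw [← hyz]
    exact inner_parallelVector_smul_add_smul _ _ _ _
  obtain ⟨e, ε, he, hz₀e, hsub, heq⟩ := exists_isBallChart_of_independent hΩ'
    (u := ![x, v]) (l := ![ω₁ z₀, ω₂ z₀])
    (Fin.forall_fin_two.2 ⟨hx,
      contDiffOn_const.inner ℝ ((h.smooth.mono hsub').sub contDiffOn_const)⟩) hz₀'
    (Fin.forall_fin_two.2 ⟨hxz₀, by simp [v]⟩)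
    (Fin.forall_fin_two.2 ⟨hdx z₀ hz₀', hdv hz₀ rfl⟩)
    (fun w hw => h.independent z₀ hz₀ w (hw 0) (hw 1))
  have hsubΩ := hsub.trans hsub'
  have hde₀ (z : E2) (hz : z ∈ e.source) : HasFDerivAt (fun z => e z 0) (ω₁ z) z :=
    (funext fun z => heq z 0 : (fun z => e z 0) = x) ▸ hdx z (hsub hz)
  have hy (z : E2) (hz : z ∈ e.source) : y z = y z₀ := he.eq_of_hasFDerivAt_zero
    (fun z hz => hdy z (hsubΩ hz) ▸ hasFDerivAt_fderiv h.isOpen h.smooth_polarAngle (hsubΩ hz))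
    hz hz₀e
  have hde₁ (z : E2) (hz : z ∈ e.source) : HasFDerivAt (fun z => e z 1) (ω₂ z) z :=
    (funext fun z => heq z 1 : (fun z => e z 1) = v) ▸ hdv (hsubΩ hz) (hy z hz)
  obtain ⟨Θ, hΘ, hθΘ⟩ := h.exists_isAngleData he hz₀e hsubΩ hde₀
  obtain ⟨C, hC⟩ :=
    h.exists_eq_profile_add_smul_parallelVector he hz₀e hsubΩ hy hde₀ hde₁ hΘ hθΘ
  refine ⟨e, Θ, _, y z₀, _, hz₀e, ⟨he.mem_maximalAtlas, fun w hw => he.mem_Ioo_of_mem_target hw 0,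
    hΘ, AffineIsometryEquiv.constVAdd ℝ E3 (-C), rfl, fun z hz => ?_⟩, h.hasAngle hn hsubΩ hθΘ⟩
  simp [caseTwo_eq, hC z hz]

end IsPrincipalFrame

end Coordinates

section Examples

variable {I J : Set ℝ} {θ φ ψ : ℝ → ℝ} {Ω : Set E2}

theorem IsAngleData.hasDerivAt (h : IsAngleData I θ φ) {x : ℝ} (hx : x ∈ I) :
    HasDerivAt θ (deriv θ x) x :=
  ((h.smooth.differentiableOn (by simp)).differentiableAt
    (h.interval.1.mem_nhds hx)).hasDerivAt

theorem hasFDerivAt_coord (i : Fin 2) (z : E2) :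
    HasFDerivAt (fun z : E2 => z i) (EuclideanSpace.proj i : E2 →L[ℝ] ℝ) z :=
  (EuclideanSpace.proj i : E2 →L[ℝ] ℝ).hasFDerivAt

theorem contDiffOn_coord (i : Fin 2) : ContDiffOn ℝ ∞ (fun z : E2 => z i) Ω :=
  (EuclideanSpace.proj i : E2 →L[ℝ] ℝ).contDiff.contDiffOn

theorem IsAngleData.isPrincipalFrame_caseOne (h : IsAngleData I θ φ) (hJ : IsIntervalAboutZero J)
    (hψ : ContDiffOn ℝ ∞ ψ J) (hΩ : IsOpen Ω) (hΩI : ∀ z ∈ Ω, z 0 ∈ I) (hΩJ : ∀ z ∈ Ω, z 1 ∈ J)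
    (hreg : ∀ z ∈ Ω, φ (z 0) + ψ (z 1) ≠ 0) :
    IsPrincipalFrame Ω (fun z => caseOne θ φ ψ (z 0) (z 1)) (fun z => θ (z 0)) (fun z => z 1)
      (fun _ => EuclideanSpace.proj 0)
      (fun z => (φ (z 0) + ψ (z 1)) • EuclideanSpace.proj 1) where
  isOpen := hΩ
  smooth := by
    simp only [caseOne_eq]
    exact (h.contDiffOn_profile (contDiffOn_coord 0) (contDiffOn_coord 1) hΩI).add
      ((contDiffOn_planeCurve hJ hψ).comp (contDiffOn_coord 1) hΩJ)
  smooth_angle := h.smooth.comp (contDiffOn_coord 0) hΩI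
  smooth_polarAngle := contDiffOn_coord 1
  mem_Ioo z hz := h.mem_Ioo _ (hΩI z hz)
  hasFDerivAt z hz := by
    simp only [caseOne_eq]
    refine ((h.hasFDerivAt_profile (hasFDerivAt_coord 0 z) (hasFDerivAt_coord 1 z)
      (hΩI z hz)).add (hasFDerivAt_comp_of_hasDerivAt
        (hasDerivAt_planeCurve hJ hψ.continuousOn (hΩJ z hz))
        (hasFDerivAt_coord 1 z))).congr_fderiv ?_
    ext1 w
    simp only [add_apply, smul_apply, ContinuousLinearMap.smulRight_apply, smul_eq_mul]
    module
  independent z hz w hw₀ hw₁ := by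
    ext i
    fin_cases i
    · exact hw₀
    · exact (mul_eq_zero_iff_left (hreg z hz)).1 hw₁
  angle z hz := ⟨deriv θ (z 0), h.deriv_ne_zero _ (hΩI z hz),
    (h.hasDerivAt (hΩI z hz)).comp_hasFDerivAt z (hasFDerivAt_coord 0 z)⟩
  polarAngle z hz := ⟨(φ (z 0) + ψ (z 1))⁻¹, by
    rw [inv_smul_smul₀ (hreg z hz)]
    exact hasFDerivAt_coord 1 z⟩

theorem IsAngleData.isPrincipalFrame_caseTwo (h : IsAngleData I θ φ) (y₀ : ℝ) (hΩ : IsOpen Ω)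
    (hΩI : ∀ z ∈ Ω, z 0 ∈ I) :
    IsPrincipalFrame Ω (fun z => caseTwo θ φ y₀ (z 0) (z 1)) (fun z => θ (z 0)) (fun _ => y₀)
      (fun _ => EuclideanSpace.proj 0) (fun _ => EuclideanSpace.proj 1) where
  isOpen := hΩ
  smooth := by
    simp only [caseTwo_eq]
    exact (h.contDiffOn_profile (contDiffOn_coord 0) contDiffOn_const hΩI).add
      ((contDiffOn_coord 1).smul contDiffOn_const)
  smooth_angle := h.smooth.comp (contDiffOn_coord 0) hΩI
  smooth_polarAngle := contDiffOn_const
  mem_Ioo z hz := h.mem_Ioo _ (hΩI z hz)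
  hasFDerivAt z hz := by
    simp only [caseTwo_eq]
    refine ((h.hasFDerivAt_profile (hasFDerivAt_coord 0 z) (hasFDerivAt_const y₀ z)
      (hΩI z hz)).add ((hasFDerivAt_coord 1 z).smul_const (parallelVector y₀))).congr_fderiv ?_
    simp
  independent z _ w hw₀ hw₁ := by
    ext i
    fin_cases i
    · exact hw₀
    · exact hw₁
  angle z hz := ⟨deriv θ (z 0), h.deriv_ne_zero _ (hΩI z hz),
    (h.hasDerivAt (hΩI z hz)).comp_hasFDerivAt z (hasFDerivAt_coord 0 z)⟩
  polarAngle z _ := ⟨0, by simpa using hasFDerivAt_const y₀ z⟩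

end Examples

section Isometries

theorem hasFDerivAt_affineIsometryEquiv_comp {E V W : Type*} [NormedAddCommGroup E]
    [NormedSpace ℝ E] [NormedAddCommGroup V] [NormedSpace ℝ V] [NormedAddCommGroup W]
    [NormedSpace ℝ W] (F : V ≃ᵃⁱ[ℝ] W) {g : E → V} {g' : E →L[ℝ] V} {z : E}
    (hg : HasFDerivAt g g' z) : HasFDerivAt (fun z => F (g z))
      ((F.linearIsometryEquiv.toContinuousLinearEquiv : V →L[ℝ] W).comp g') z := by
  have hF (x : V) : F x = F.linearIsometryEquiv x + F 0 := by
    simpa only [vadd_eq_add, add_zero] using F.map_vadd 0 x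
  exact (((F.linearIsometryEquiv.toContinuousLinearEquiv : V →L[ℝ] W).hasFDerivAt.comp z
    hg).add_const (F 0)).congr_of_eventuallyEq (.of_forall fun z => hF (g z))

theorem IsCanonicalPatch.map {k : E3} {g n : E2 → E3} {Ω : Set E2}
    (h : IsCanonicalPatch k g n Ω) (F : E3 ≃ᵃⁱ[ℝ] E3) :
    IsCanonicalPatch (F.linearIsometryEquiv k) (fun z => F (g z))
      (fun z => F.linearIsometryEquiv (n z)) Ω := by
  have hFg (z : E2) (hz : z ∈ Ω) (w : E2) :
      fderiv ℝ (fun z => F (g z)) z w = F.linearIsometryEquiv (fderiv ℝ g z w) := by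
    rw [(hasFDerivAt_affineIsometryEquiv_comp F
      (hasFDerivAt_fderiv h.isOpen h.smooth hz)).fderiv]
    rfl
  have hLn (z : E2) (w : E2) : fderiv ℝ (fun z => F.linearIsometryEquiv (n z)) z w =
      F.linearIsometryEquiv (fderiv ℝ n z w) :=
    congrArg (fun l : E2 →L[ℝ] E3 => l w) (F.linearIsometryEquiv.comp_fderiv (f := n))
  refine ⟨h.isOpen, ?_, F.linearIsometryEquiv.contDiff.comp_contDiffOn h.smooth_normal,
    fun z hz a b hab => ?_, fun z hz => ?_, fun z hz w => ?_, fun z hz => ?_⟩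
  · exact F.toContinuousAffineEquiv.toContinuousAffineMap.contDiff.comp_contDiffOn h.smooth
  · rw [hFg z hz, hFg z hz] at hab
    exact h.injective z hz (F.linearIsometryEquiv.injective hab)
  · rw [LinearIsometryEquiv.norm_map, h.norm_eq_one z hz]
  · rw [hFg z hz, LinearIsometryEquiv.inner_map_map, h.orthogonal z hz]
  · obtain ⟨w, c, hw, hc, hgw, hnw⟩ := h.principal z hz
    refine ⟨w, c, hw, hc, ?_, ?_⟩
    · rw [hFg z hz, hgw, LinearIsometryEquiv.inner_map_map, map_sub, map_smul]
    · rw [hLn, hnw, hFg z hz, map_neg, map_smul]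

end Isometries

section LocalForm

theorem exists_linearIsometryEquiv_eq_e3 {k n : E3} (hk : ‖k‖ = 1) (hn : n ≠ inner ℝ k n • k) :
    ∃ L : E3 ≃ₗᵢ[ℝ] E3, L k = e3 ∧ L n 0 < 0 ∧ L n 1 = 0 := by
  let m : E3 := inner ℝ k n • k - n
  have hm : m ≠ 0 := sub_ne_zero.2 hn.symm
  have hm0 : ‖m‖ ≠ 0 := norm_ne_zero_iff.2 hm
  have hkm : inner ℝ k m = 0 := by
    simp [m, inner_sub_right, inner_smul_right, real_inner_self_eq_norm_sq, hk,
      -inner_self_eq_norm_sq_to_K]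
  let v : Fin 3 → E3 := ![‖m‖⁻¹ • m, 0, k]
  have hv : Orthonormal ℝ (({0, 2} : Set (Fin 3)).domRestrict v) := by
    have hmk : inner ℝ m k = 0 := by rw [real_inner_comm, hkm]
    rw [orthonormal_iff_ite]
    rintro ⟨i, rfl | rfl⟩ ⟨j, rfl | rfl⟩ <;>
      simp [v, Subtype.ext_iff, inner_smul_left, inner_smul_right, hkm, hmk, hk, hm0,
        real_inner_self_eq_norm_sq, sq, -inner_self_eq_norm_sq_to_K]
  obtain ⟨b, hb⟩ := hv.exists_orthonormalBasis_extension_of_card_eq (by simp)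
  have hb0 : ‖m‖ • b 0 = m := by
    rw [hb 0 (by simp)]
    exact smul_inv_smul₀ hm0 m
  have hb2 : b 2 = k := hb 2 (by simp)
  have hn_eq : n = inner ℝ k n • b 2 - ‖m‖ • b 0 := by
    rw [hb0, hb2, sub_sub_cancel]
  refine ⟨b.repr, ?_, ?_, ?_⟩
  · rw [← hb2, b.repr_self]
    ext i
    fin_cases i <;> simp [e3]
  · rw [hn_eq]
    simpa using hm
  · rw [hn_eq]
    simp

namespace IsCanonicalPatch

variable {k : E3} {g n : E2 → E3} {Ω : Set E2} {z₀ : E2}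

theorem mono (h : IsCanonicalPatch k g n Ω) {Ω' : Set E2} (hΩ' : IsOpen Ω') (hsub : Ω' ⊆ Ω) :
    IsCanonicalPatch k g n Ω' where
  isOpen := hΩ'
  smooth := h.smooth.mono hsub
  smooth_normal := h.smooth_normal.mono hsub
  injective z hz := h.injective z (hsub hz)
  norm_eq_one z hz := h.norm_eq_one z (hsub hz)
  orthogonal z hz := h.orthogonal z (hsub hz)
  principal z hz := h.principal z (hsub hz)

theorem ne_inner_smul (h : IsCanonicalPatch k g n Ω) (hz₀ : z₀ ∈ Ω) :
    n z₀ ≠ inner ℝ k (n z₀) • k := fun hn => by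
  obtain ⟨w, -, hw, -, hgw, -⟩ := h.principal z₀ hz₀
  have hng := h.orthogonal z₀ hz₀ w
  have hkg : inner ℝ k (fderiv ℝ g z₀ w) = 0 := by
    rw [hn, inner_smul_left] at hng
    refine (mul_eq_zero.1 hng).resolve_left fun hkn => ?_
    have hn₀ : n z₀ = 0 := hn.trans (by rw [show inner ℝ k (n z₀) = 0 from hkn, zero_smul])
    simpa [hn₀] using h.norm_eq_one z₀ hz₀
  have hzero : inner ℝ (fderiv ℝ g z₀ w) (fderiv ℝ g z₀ w) = 0 := by
    nth_rw 1 [hgw]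
    rw [inner_sub_left, inner_smul_left, hkg, hng, mul_zero, sub_zero]
  exact hw (h.injective z₀ hz₀ ((inner_self_eq_zero.1 hzero).trans (map_zero _).symm))

theorem exists_isPrincipalFrame (h : IsCanonicalPatch k g n Ω) (hk : ‖k‖ = 1) (hz₀ : z₀ ∈ Ω) :
    ∃ (L : E3 ≃ₗᵢ[ℝ] E3) (Ω' : Set E2) (θ y : E2 → ℝ) (ω₁ ω₂ : E2 → E2 →L[ℝ] ℝ),
      L k = e3 ∧ z₀ ∈ Ω' ∧ Ω' ⊆ Ω ∧ y z₀ = 0 ∧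
      IsPrincipalFrame Ω' (fun z => L (g z)) θ y ω₁ ω₂ ∧
      ∀ z ∈ Ω', L (n z) = normalVector (θ z) (y z) := by
  obtain ⟨L, hLk, hLn₀, hLn₁⟩ := exists_linearIsometryEquiv_eq_e3 hk (h.ne_inner_smul hz₀)
  have hL : IsCanonicalPatch e3 (fun z => L (g z)) (fun z => L (n z)) Ω :=
    hLk ▸ h.map L.toAffineIsometryEquiv
  let Ω' : Set E2 := Ω ∩ (fun z => L (n z) 0) ⁻¹' Set.Iio 0
  have hΩ' : IsOpen Ω' :=
    (contDiffOn_euclidean.1 hL.smooth_normal 0).continuousOn.isOpen_inter_preimage h.isOpen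
      isOpen_Iio
  have hL' := hL.mono hΩ' Set.inter_subset_left
  obtain ⟨θ, y, hθ, hy, hmem, hy₀, hn⟩ :=
    exists_eq_normalVector hL'.smooth_normal hL'.norm_eq_one fun z hz => hz.2
  exact ⟨L, Ω', θ, y, _, _, hLk, ⟨hz₀, hLn₀⟩, Set.inter_subset_left, hy₀ z₀ hLn₁,
    hL'.isPrincipalFrame hθ hy hmem hn, hn⟩

end IsCanonicalPatch

theorem IsPrincipalFrame.fderiv_normal_eq_zero_iff {Ω : Set E2} {f n : E2 → E3} {θ y : E2 → ℝ}
    {ω₁ ω₂ : E2 → E2 →L[ℝ] ℝ} (h : IsPrincipalFrame Ω f θ y ω₁ ω₂) {L : E3 ≃ₗᵢ[ℝ] E3}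
    (hn : ∀ z ∈ Ω, L (n z) = normalVector (θ z) (y z)) {z : E2} (hz : z ∈ Ω) :
    (∃ w ≠ 0, fderiv ℝ n z w = 0) ↔ fderiv ℝ y z = 0 := by
  rw [← h.fderiv_normalVector_eq_zero_iff hz, ← Filter.EventuallyEq.fderiv_eq
    (Filter.mem_of_superset (h.isOpen.mem_nhds hz) hn)]
  refine exists_congr fun w => and_congr_right fun _ => ?_
  rw [show fderiv ℝ (fun z => L (n z)) z w = L (fderiv ℝ n z w) from
    congrArg (fun l : E2 →L[ℝ] E3 => l w) (L.comp_fderiv (f := n))]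
  exact (map_eq_zero_iff L L.injective).symm

section Isometry

variable {M : Type*} [TopologicalSpace M] {f N : M → E3} {k : E3} {p : M}

theorem HasAngle.of_linearIsometryEquiv {L : E3 ≃ₗᵢ[ℝ] E3} {e : OpenPartialHomeomorph M E2}
    {θ : ℝ → ℝ} (h : HasAngle (fun q => L (N q)) (L k) e θ) : HasAngle N k e θ := fun q hq => by
  rw [← h q hq]
  exact (L.toLinearIsometry.angle_map (N q) k).symm

variable [ChartedSpace E2 M]

theorem IsCaseOneNear.of_linearIsometryEquiv {L : E3 ≃ₗᵢ[ℝ] E3}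
    (h : IsCaseOneNear (fun q => L (f q)) (fun q => L (N q)) (L k) p) : IsCaseOneNear f N k p := by
  obtain ⟨e, θ, φ, ψ, I, J, hp, ⟨he, htarget, hθ, hJ, hψ, hreg, F, hF, hform⟩, hangle⟩ := h
  exact ⟨e, θ, φ, ψ, I, J, hp, ⟨he, htarget, hθ, hJ, hψ, hreg, L.toAffineIsometryEquiv.trans F,
    hF, hform⟩, hangle.of_linearIsometryEquiv⟩

theorem IsCaseTwoNear.of_linearIsometryEquiv {L : E3 ≃ₗᵢ[ℝ] E3}
    (h : IsCaseTwoNear (fun q => L (f q)) (fun q => L (N q)) (L k) p) : IsCaseTwoNear f N k p := by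
  obtain ⟨e, θ, φ, y₀, I, hp, ⟨he, htarget, hθ, F, hF, hform⟩, hangle⟩ := h
  exact ⟨e, θ, φ, y₀, I, hp, ⟨he, htarget, hθ, L.toAffineIsometryEquiv.trans F, hF, hform⟩,
    hangle.of_linearIsometryEquiv⟩

end Isometry

namespace IsCanonicalPatch

variable {k : E3} {g n : E2 → E3} {Ω : Set E2} {z₀ : E2}

theorem isCaseOneNear (h : IsCanonicalPatch k g n Ω) (hk : ‖k‖ = 1) (hz₀ : z₀ ∈ Ω)
    (hK : ¬∃ w ≠ 0, fderiv ℝ n z₀ w = 0) : IsCaseOneNear g n k z₀ := by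
  obtain ⟨L, Ω', θ, y, ω₁, ω₂, hLk, hz₀', -, hy, hframe, hn⟩ := h.exists_isPrincipalFrame hk hz₀
  rw [hframe.fderiv_normal_eq_zero_iff hn hz₀'] at hK
  refine IsCaseOneNear.of_linearIsometryEquiv (L := L) ?_
  rw [hLk]
  exact hframe.isCaseOneNear hn hz₀' hy hK

theorem isCaseTwoNear (h : IsCanonicalPatch k g n Ω) (hk : ‖k‖ = 1) (hz₀ : z₀ ∈ Ω)
    (hK : ∀ z ∈ Ω, ∃ w ≠ 0, fderiv ℝ n z w = 0) : IsCaseTwoNear g n k z₀ := by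
  obtain ⟨L, Ω', θ, y, ω₁, ω₂, hLk, hz₀', hsub, -, hframe, hn⟩ :=
    h.exists_isPrincipalFrame hk hz₀
  refine IsCaseTwoNear.of_linearIsometryEquiv (L := L) ?_
  rw [hLk]
  exact hframe.isCaseTwoNear hn hz₀' fun z hz =>
    (hframe.fderiv_normal_eq_zero_iff hn hz).1 (hK z (hsub hz))

end IsCanonicalPatch

end LocalForm

section MaximalAtlas

variable {E H M : Type*} [NormedAddCommGroup E] [NormedSpace ℝ E] [TopologicalSpace H]
  {I : ModelWithCorners ℝ E H} [TopologicalSpace M] [ChartedSpace H M] {r : ℕ∞ω}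
  {e : OpenPartialHomeomorph M H}

theorem mdifferentiable_of_mem_maximalAtlas (he : e ∈ IsManifold.maximalAtlas I r M)
    (hr : r ≠ 0) : e.MDifferentiable I I :=
  ⟨(contMDiffOn_of_mem_maximalAtlas he).mdifferentiableOn hr,
    (contMDiffOn_symm_of_mem_maximalAtlas he).mdifferentiableOn hr⟩

theorem trans_mem_maximalAtlas [IsManifold I r M] (he : e ∈ IsManifold.maximalAtlas I r M)
    {e' : OpenPartialHomeomorph H H} (he' : e' ∈ IsManifold.maximalAtlas I r H) :
    e.trans e' ∈ IsManifold.maximalAtlas I r M := by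
  refine (e.trans e').mem_maximalAtlas_of_contMDiffOn ?_ ?_
  · exact (contMDiffOn_of_mem_maximalAtlas he').comp
      ((contMDiffOn_of_mem_maximalAtlas he).mono fun _ hq => hq.1) fun _ hq => hq.2
  · exact (contMDiffOn_symm_of_mem_maximalAtlas he).comp
      ((contMDiffOn_symm_of_mem_maximalAtlas he').mono fun _ hz => hz.1) fun _ hz => hz.2

end MaximalAtlas

section Charts

variable {M : Type*} [TopologicalSpace M] [ChartedSpace E2 M] {e : OpenPartialHomeomorph M E2}
  {f : M → E3} {g : E2 → E3} {q : M} {z : E2}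

/-- The differential at `q` of a smooth chart of a surface, as an isomorphism onto the coordinate
plane. -/
def chartDiff (he : e ∈ IsManifold.maximalAtlas (𝓡 2) ∞ M) (hq : q ∈ e.source) :
    TangentSpace (𝓡 2) q ≃L[ℝ] E2 :=
  (mdifferentiable_of_mem_maximalAtlas he (by simp)).mfderiv hq

theorem diff_eq_fderiv_chartDiff (he : e ∈ IsManifold.maximalAtlas (𝓡 2) ∞ M)
    (hq : q ∈ e.source) (hfg : ∀ q ∈ e.source, f q = g (e q))
    (hg : DifferentiableAt ℝ g (e q)) (v : TangentSpace (𝓡 2) q) :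
    diff f q v = fderiv ℝ g (e q) (chartDiff he hq v) := by
  have hge : HasMFDerivAt (𝓡 2) 𝓘(ℝ, E3) (g ∘ e) q _ := hg.hasFDerivAt.hasMFDerivAt.comp q
    ((mdifferentiable_of_mem_maximalAtlas he (by simp)).mdifferentiableAt hq).hasMFDerivAt
  have hfge : f =ᶠ[nhds q] g ∘ e := Filter.mem_of_superset (e.open_source.mem_nhds hq) hfg
  exact congrArg (fun T => T v) (hge.congr_of_eventuallyEq hfge).mfderiv

theorem contMDiff_of_eq_comp (he : e ∈ IsManifold.maximalAtlas (𝓡 2) ∞ M)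
    (hsrc : e.source = Set.univ) (hfg : ∀ q, f q = g (e q)) (hg : ContDiffOn ℝ ∞ g e.target) :
    ContMDiff (𝓡 2) 𝓘(ℝ, E3) ∞ f := by
  rw [funext hfg, ← contMDiffOn_univ, ← hsrc]
  exact hg.contMDiffOn.comp (contMDiffOn_of_mem_maximalAtlas he) fun _ => e.map_source

theorem contDiffOn_comp_symm (he : e ∈ IsManifold.maximalAtlas (𝓡 2) ∞ M)
    (hf : ContMDiff (𝓡 2) 𝓘(ℝ, E3) ∞ f) : ContDiffOn ℝ ∞ (fun z => f (e.symm z)) e.target :=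
  contMDiffOn_iff_contDiffOn.1 (hf.comp_contMDiffOn (contMDiffOn_symm_of_mem_maximalAtlas he))

theorem fderiv_comp_symm_chartDiff (he : e ∈ IsManifold.maximalAtlas (𝓡 2) ∞ M)
    (hf : ContMDiff (𝓡 2) 𝓘(ℝ, E3) ∞ f) (hz : z ∈ e.target)
    (v : TangentSpace (𝓡 2) (e.symm z)) :
    fderiv ℝ (fun z => f (e.symm z)) z (chartDiff he (e.map_target hz) v) =
      diff f (e.symm z) v := by
  have hd : DifferentiableAt ℝ (fun z => f (e.symm z)) (e (e.symm z)) := by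
    rw [e.right_inv hz]
    exact (hasFDerivAt_fderiv e.open_target (contDiffOn_comp_symm he hf) hz).differentiableAt
  rw [diff_eq_fderiv_chartDiff he (e.map_target hz) (g := fun z => f (e.symm z))
    (fun q hq => by rw [e.left_inv hq]) hd, e.right_inv hz]

end Charts

section Surfaces

variable {M : Type*} [TopologicalSpace M] [ChartedSpace E2 M] {f N N' : M → E3} {k : E3}

theorem gaussCurvature_eq_zero_iff (hf : IsSmoothImmersion f) (hN : IsUnitNormal f N) (p : M) :
    gaussCurvature f N p = 0 ↔ ∃ v ≠ 0, diff N p v = 0 := by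
  have : FiniteDimensional ℝ (TangentSpace (𝓡 2) p) := inferInstanceAs (FiniteDimensional ℝ E2)
  have hA (v : TangentSpace (𝓡 2) p) : shapeOperator f N p v = 0 ↔ diff N p v = 0 := by
    rw [← (hf.injective p).eq_iff, map_zero, diff_shapeOperator hf hN, neg_eq_zero]
  rw [gaussCurvature, LinearMap.det_eq_zero_iff_ker_ne_bot, Submodule.ne_bot_iff]
  simp only [LinearMap.mem_ker, hA, and_comm, ne_eq]

theorem isCanonicalPrincipal_iff (hf : IsSmoothImmersion f) (hN : IsUnitNormal f N) :
    IsCanonicalPrincipal f N k ↔ ∀ p, ∃ (v : TangentSpace (𝓡 2) p) (c : ℝ), v ≠ 0 ∧ c ≠ 0 ∧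
      diff f p v = k - inner ℝ k (N p) • N p ∧ diff N p v = -(c • diff f p v) := by
  have hU (p : M) : diff f p (tangentPart f N k p) = k - inner ℝ k (N p) • N p :=
    eq_sub_of_add_eq (diff_tangentPart hf hN k p)
  have hA (p : M) (v : TangentSpace (𝓡 2) p) (c : ℝ) :
      shapeOperator f N p v = c • v ↔ diff N p v = -(c • diff f p v) := by
    rw [← (hf.injective p).eq_iff, diff_shapeOperator hf hN, map_smul, neg_eq_iff_eq_neg]
  refine forall_congr' fun p => ⟨?_, ?_⟩
  · rintro ⟨hU0, c, hc, hAU⟩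
    exact ⟨_, c, hU0, hc, hU p, (hA p _ c).1 hAU⟩
  · rintro ⟨v, c, hv, hc, hfv, hNv⟩
    obtain rfl : v = tangentPart f N k p := hf.injective p (hfv.trans (hU p).symm)
    exact ⟨hv, c, hc, (hA p _ c).2 hNv⟩

theorem IsUnitNormal.neg (hN : IsUnitNormal f N) : IsUnitNormal f (-N) where
  smooth := hN.smooth.neg
  norm_eq_one p := by rw [Pi.neg_apply, norm_neg, hN.norm_eq_one]
  orthogonal p v := by rw [Pi.neg_apply, inner_neg_left, hN.orthogonal, neg_zero]

theorem IsUnitNormal.eq_or_eq_neg (hf : IsSmoothImmersion f) (hN : IsUnitNormal f N)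
    (hN' : IsUnitNormal f N') (p : M) : N' p = N p ∨ N' p = -N p := by
  have hself : inner ℝ (N p) (N p) = (1 : ℝ) := by
    rw [real_inner_self_eq_norm_sq, hN.norm_eq_one, one_pow]
  obtain ⟨v, hv⟩ := mem_range_of_inner_eq_zero hf hN (p := p)
    (w := N' p - inner ℝ (N p) (N' p) • N p) (by
      rw [inner_sub_right, inner_smul_right, hself, mul_one, sub_self])
  have hzero : inner ℝ (diff f p v) (diff f p v) = 0 := by
    nth_rw 1 [hv]
    rw [inner_sub_left, inner_smul_left, hN'.orthogonal, hN.orthogonal, mul_zero, sub_zero]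
  rw [inner_self_eq_zero.1 hzero, eq_comm, sub_eq_zero] at hv
  have habs : |inner ℝ (N p) (N' p)| = 1 := by
    rw [← hN'.norm_eq_one p, hv, norm_smul, hN.norm_eq_one, mul_one, ← hv, Real.norm_eq_abs]
  rcases (abs_eq zero_le_one).1 habs with h | h
  · exact Or.inl (by rw [hv, h, one_smul])
  · exact Or.inr (by rw [hv, h, neg_one_smul])

theorem IsUnitNormal.eventuallyEq (hf : IsSmoothImmersion f) (hN : IsUnitNormal f N)
    (hN' : IsUnitNormal f N') {p : M} (hp : N' p = N p) : N' =ᶠ[nhds p] N := by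
  have hsum : N' p + N p ≠ 0 := fun h => by
    rw [hp, ← two_smul ℝ, smul_eq_zero_iff_right two_ne_zero] at h
    simpa [h] using hN.norm_eq_one p
  filter_upwards [(hN'.smooth.continuous.add hN.smooth.continuous).continuousAt.eventually_ne hsum]
    with q hq
  exact (hN.eq_or_eq_neg hf hN' q).resolve_right fun h => hq (by simp [h])

theorem IsCanonicalPrincipal.of_isUnitNormal (h : IsCanonicalPrincipal f N k)
    (hf : IsSmoothImmersion f) (hN : IsUnitNormal f N) (hN' : IsUnitNormal f N') :
    IsCanonicalPrincipal f N' k := by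
  rw [isCanonicalPrincipal_iff hf hN] at h
  refine (isCanonicalPrincipal_iff hf hN').2 fun p => ?_
  obtain ⟨v, c, hv, hc, hfv, hNv⟩ := h p
  rcases hN.eq_or_eq_neg hf hN' p with hp | hp
  · have hdiff : diff N' p = diff N p := (hN.eventuallyEq hf hN' hp).mfderiv_eq
    exact ⟨v, c, hv, hc, by rw [hp, hfv], by rw [hdiff, hNv]⟩
  · have hdiff : diff N' p = -diff N p :=
      (hN.neg.eventuallyEq hf hN' hp).mfderiv_eq.trans mfderiv_neg
    refine ⟨v, -c, hv, neg_ne_zero.2 hc, ?_, ?_⟩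
    · rw [hp, hfv, inner_neg_right, neg_smul_neg]
    · rw [hdiff, neg_smul, neg_neg]
      exact (congrArg Neg.neg hNv).trans (neg_neg _)

end Surfaces

section Classification

variable {M : Type*} [TopologicalSpace M] [ChartedSpace E2 M] {f N : M → E3} {k : E3} {p : M}
  {e : OpenPartialHomeomorph M E2}

theorem IsCanonicalPrincipal.isCanonicalPatch (h : IsCanonicalPrincipal f N k)
    (hf : IsSmoothImmersion f) (hN : IsUnitNormal f N)
    (he : e ∈ IsManifold.maximalAtlas (𝓡 2) ∞ M) :
    IsCanonicalPatch k (fun z => f (e.symm z)) (fun z => N (e.symm z)) e.target where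
  isOpen := e.open_target
  smooth := contDiffOn_comp_symm he hf.smooth
  smooth_normal := contDiffOn_comp_symm he hN.smooth
  injective z hz := by
    have hcomp := hf.injective (e.symm z)
    rw [← funext (fderiv_comp_symm_chartDiff he hf.smooth hz)] at hcomp
    exact hcomp.of_comp_right (chartDiff he (e.map_target hz)).surjective
  norm_eq_one z _ := hN.norm_eq_one _
  orthogonal z hz w := by
    obtain ⟨v, rfl⟩ := (chartDiff he (e.map_target hz)).surjective w
    rw [fderiv_comp_symm_chartDiff he hf.smooth hz, hN.orthogonal]
  principal z hz := by
    obtain ⟨v, c, hv, hc, hfv, hNv⟩ := (isCanonicalPrincipal_iff hf hN).1 h (e.symm z)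
    refine ⟨chartDiff he (e.map_target hz) v, c, ?_, hc, ?_, ?_⟩
    · rwa [Ne, (chartDiff he (e.map_target hz)).map_eq_zero_iff]
    · rw [fderiv_comp_symm_chartDiff he hf.smooth hz, hfv]
    · rw [fderiv_comp_symm_chartDiff he hf.smooth hz,
        fderiv_comp_symm_chartDiff he hN.smooth hz, hNv]

theorem gaussCurvature_symm_eq_zero_iff (hf : IsSmoothImmersion f) (hN : IsUnitNormal f N)
    (he : e ∈ IsManifold.maximalAtlas (𝓡 2) ∞ M) {z : E2} (hz : z ∈ e.target) :
    gaussCurvature f N (e.symm z) = 0 ↔ ∃ w ≠ 0, fderiv ℝ (fun z => N (e.symm z)) z w = 0 := by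
  rw [gaussCurvature_eq_zero_iff hf hN, (chartDiff he (e.map_target hz)).surjective.exists]
  refine exists_congr fun v => ?_
  rw [fderiv_comp_symm_chartDiff he hN.smooth hz, Ne, Ne,
    (chartDiff he (e.map_target hz)).map_eq_zero_iff]

section Transport

variable [IsManifold (𝓡 2) ∞ M]

theorem IsCaseOneNear.of_comp_symm (he : e ∈ IsManifold.maximalAtlas (𝓡 2) ∞ M)
    (hp : p ∈ e.source)
    (h : IsCaseOneNear (fun z => f (e.symm z)) (fun z => N (e.symm z)) k (e p)) :
    IsCaseOneNear f N k p := by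
  obtain ⟨e', θ, φ, ψ, I, J, hp', ⟨he', htarget, hθ, hJ, hψ, hreg, F, hF, hform⟩, hangle⟩ := h
  refine ⟨e.trans e', θ, φ, ψ, I, J, ⟨hp, hp'⟩, ⟨trans_mem_maximalAtlas he he',
    fun z hz => htarget z hz.1, hθ, hJ, hψ, fun z hz => hreg z hz.1, F, hF, fun q hq => ?_⟩,
    fun q hq => ?_⟩
  · simpa only [OpenPartialHomeomorph.coe_trans, Function.comp_apply, e.left_inv hq.1] using
      hform (e q) hq.2
  · simpa only [OpenPartialHomeomorph.coe_trans, Function.comp_apply, e.left_inv hq.1] using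
      hangle (e q) hq.2

theorem IsCaseTwoNear.of_comp_symm (he : e ∈ IsManifold.maximalAtlas (𝓡 2) ∞ M)
    (hp : p ∈ e.source)
    (h : IsCaseTwoNear (fun z => f (e.symm z)) (fun z => N (e.symm z)) k (e p)) :
    IsCaseTwoNear f N k p := by
  obtain ⟨e', θ, φ, y₀, I, hp', ⟨he', htarget, hθ, F, hF, hform⟩, hangle⟩ := h
  refine ⟨e.trans e', θ, φ, y₀, I, ⟨hp, hp'⟩, ⟨trans_mem_maximalAtlas he he',
    fun z hz => htarget z hz.1, hθ, F, hF, fun q hq => ?_⟩, fun q hq => ?_⟩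
  · simpa only [OpenPartialHomeomorph.coe_trans, Function.comp_apply, e.left_inv hq.1] using
      hform (e q) hq.2
  · simpa only [OpenPartialHomeomorph.coe_trans, Function.comp_apply, e.left_inv hq.1] using
      hangle (e q) hq.2

theorem isCaseOneNear_of_gaussCurvature_ne_zero (hk : ‖k‖ = 1) (hf : IsSmoothImmersion f)
    (hN : IsUnitNormal f N) (hcan : IsCanonicalPrincipal f N k) (hK : gaussCurvature f N p ≠ 0) :
    IsCaseOneNear f N k p := by
  have he : chartAt E2 p ∈ IsManifold.maximalAtlas (𝓡 2) ∞ M := IsManifold.chart_mem_maximalAtlas p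
  have hp := mem_chart_source E2 p
  have hpt := mem_chart_target E2 p
  refine .of_comp_symm he hp ((hcan.isCanonicalPatch hf hN he).isCaseOneNear hk hpt ?_)
  rwa [← gaussCurvature_symm_eq_zero_iff hf hN he hpt, (chartAt E2 p).left_inv hp]

theorem isCaseTwoNear_of_eventually_gaussCurvature_eq_zero (hk : ‖k‖ = 1)
    (hf : IsSmoothImmersion f) (hN : IsUnitNormal f N) (hcan : IsCanonicalPrincipal f N k)
    (hK : ∀ᶠ q in nhds p, gaussCurvature f N q = 0) : IsCaseTwoNear f N k p := by
  have he : chartAt E2 p ∈ IsManifold.maximalAtlas (𝓡 2) ∞ M := IsManifold.chart_mem_maximalAtlas p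
  have hp := mem_chart_source E2 p
  obtain ⟨O, hKO, hO, hpO⟩ := eventually_nhds_iff.1 hK
  have hpatch := (hcan.isCanonicalPatch hf hN he).mono
    ((chartAt E2 p).isOpen_inter_preimage_symm hO) Set.inter_subset_left
  refine .of_comp_symm he hp (hpatch.isCaseTwoNear hk ⟨mem_chart_target E2 p, ?_⟩ fun z hz =>
    (gaussCurvature_symm_eq_zero_iff hf hN he hz.1).1 (hKO _ hz.2))
  rwa [Set.mem_preimage, (chartAt E2 p).left_inv hp]

end Transport

theorem IsCanonicalPatch.isCanonicalSurface {g n : E2 → E3} (h : IsCanonicalPatch k g n e.target)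
    (he : e ∈ IsManifold.maximalAtlas (𝓡 2) ∞ M) (hsrc : e.source = Set.univ)
    (hfg : ∀ q, f q = g (e q)) {θ : ℝ → ℝ}
    (hangle : ∀ z ∈ e.target, InnerProductGeometry.angle (n z) k = θ (z 0)) :
    IsCanonicalSurface f k e θ := by
  have hsource (q : M) : q ∈ e.source := hsrc ▸ Set.mem_univ q
  have htarget (q : M) : e q ∈ e.target := e.map_source (hsource q)
  have hdf (q : M) (v : TangentSpace (𝓡 2) q) :
      diff f q v = fderiv ℝ g (e q) (chartDiff he (hsource q) v) :=
    diff_eq_fderiv_chartDiff he (hsource q) (fun q _ => hfg q)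
      (hasFDerivAt_fderiv h.isOpen h.smooth (htarget q)).differentiableAt v
  have hdn (q : M) (v : TangentSpace (𝓡 2) q) :
      diff (fun q => n (e q)) q v = fderiv ℝ n (e q) (chartDiff he (hsource q) v) :=
    diff_eq_fderiv_chartDiff he (hsource q) (fun q _ => rfl)
      (hasFDerivAt_fderiv h.isOpen h.smooth_normal (htarget q)).differentiableAt v
  have hf : IsSmoothImmersion f := ⟨contMDiff_of_eq_comp he hsrc hfg h.smooth, fun q v v' hv => by
    rw [hdf, hdf] at hv
    exact (chartDiff he (hsource q)).injective (h.injective _ (htarget q) hv)⟩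
  have hN : IsUnitNormal f fun q => n (e q) :=
    ⟨contMDiff_of_eq_comp he hsrc (fun _ => rfl) h.smooth_normal,
      fun q => h.norm_eq_one _ (htarget q), fun q v => by rw [hdf, h.orthogonal _ (htarget q)]⟩
  have hcan : IsCanonicalPrincipal f (fun q => n (e q)) k :=
    (isCanonicalPrincipal_iff hf hN).2 fun q => by
      obtain ⟨w, c, hw, hc, hgw, hnw⟩ := h.principal _ (htarget q)
      obtain ⟨v, rfl⟩ := (chartDiff he (hsource q)).surjective w
      rw [← hdf] at hgw
      rw [← hdf, ← hdn] at hnw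
      exact ⟨v, c, fun hv => hw (by rw [hv, map_zero]), hc, hgw, hnw⟩
  exact ⟨hf, ⟨_, hN, fun q _ => hangle _ (htarget q)⟩, fun _ hN' => hcan.of_isUnitNormal hf hN hN'⟩

theorem IsPrincipalFrame.isCanonicalSurface {r : E2 → E3} {θ : ℝ → ℝ} {y : E2 → ℝ}
    {ω₁ ω₂ : E2 → E2 →L[ℝ] ℝ}
    (h : IsPrincipalFrame e.target r (fun z => θ (z 0)) y ω₁ ω₂)
    (he : e ∈ IsManifold.maximalAtlas (𝓡 2) ∞ M) (hsrc : e.source = Set.univ)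
    {F : E3 ≃ᵃⁱ[ℝ] E3} (hF : F.linearIsometryEquiv k = e3) (hfr : ∀ q, F (f q) = r (e q)) :
    IsCanonicalSurface f k e θ := by
  have hk : F.symm.linearIsometryEquiv e3 = k := by
    rw [← hF]
    exact F.linearIsometryEquiv.symm_apply_apply k
  have hpatch := h.isCanonicalPatch.map F.symm
  rw [hk] at hpatch
  refine hpatch.isCanonicalSurface he hsrc (fun q => ?_) fun z hz => ?_
  · rw [← hfr, F.symm_apply_apply]
  · rw [← hk]
    exact (F.symm.linearIsometryEquiv.toLinearIsometry.angle_map _ _).trans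
      (angle_normalVector_e3 (Set.Ioo_subset_Icc_self (h.mem_Ioo z hz)) _)

theorem IsCaseOne.isCanonicalSurface {θ φ ψ : ℝ → ℝ} {I J : Set ℝ}
    (h : IsCaseOne f k e θ φ ψ I J) (hsrc : e.source = Set.univ) :
    IsCanonicalSurface f k e θ := by
  obtain ⟨F, hF, hform⟩ := h.formula
  exact (h.angleData.isPrincipalFrame_caseOne h.interval h.smooth e.open_target
    (fun z hz => (h.target z hz).1) (fun z hz => (h.target z hz).2)
    h.regular).isCanonicalSurface h.chart hsrc hF fun q => hform q (hsrc ▸ Set.mem_univ q)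

theorem IsCaseTwo.isCanonicalSurface {θ φ : ℝ → ℝ} {y₀ : ℝ} {I : Set ℝ}
    (h : IsCaseTwo f k e θ φ y₀ I) (hsrc : e.source = Set.univ) :
    IsCanonicalSurface f k e θ := by
  obtain ⟨F, hF, hform⟩ := h.formula
  exact (h.angleData.isPrincipalFrame_caseTwo y₀ e.open_target h.target).isCanonicalSurface
    h.chart hsrc hF fun q => hform q (hsrc ▸ Set.mem_univ q)

end Classification

end CanonicalDirection

end

open CanonicalDirection in
theorem mainTheorem1 {M : Type*} [TopologicalSpace M] [ChartedSpace E2 M]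
    [IsManifold (𝓡 2) ∞ M] (k : E3) (hk : ‖k‖ = 1) :
    (∀ f N : M → E3, IsSmoothImmersion f → IsUnitNormal f N → IsCanonicalPrincipal f N k →
      (∀ p, gaussCurvature f N p ≠ 0 → IsCaseOneNear f N k p) ∧
      (∀ p, (∀ᶠ q in nhds p, gaussCurvature f N q = 0) → IsCaseTwoNear f N k p) ∧
      Dense {p | IsCaseOneNear f N k p ∨ IsCaseTwoNear f N k p}) ∧
    (∀ (f : M → E3) (e : OpenPartialHomeomorph M E2) (θ φ ψ : ℝ → ℝ) (I J : Set ℝ),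
      e.source = Set.univ → IsCaseOne f k e θ φ ψ I J → IsCanonicalSurface f k e θ) ∧
    (∀ (f : M → E3) (e : OpenPartialHomeomorph M E2) (θ φ : ℝ → ℝ) (y₀ : ℝ) (I : Set ℝ),
      e.source = Set.univ → IsCaseTwo f k e θ φ y₀ I → IsCanonicalSurface f k e θ) := by
  refine ⟨fun f N hf hN hcan => ?_, fun f e θ φ ψ I J hsrc h => h.isCanonicalSurface hsrc,
    fun f e θ φ y₀ I hsrc h => h.isCanonicalSurface hsrc⟩
  have hone : ∀ p, gaussCurvature f N p ≠ 0 → IsCaseOneNear f N k p := fun p hp =>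
    isCaseOneNear_of_gaussCurvature_ne_zero hk hf hN hcan hp
  have htwo : ∀ p, (∀ᶠ q in nhds p, gaussCurvature f N q = 0) → IsCaseTwoNear f N k p :=
    fun p hp => isCaseTwoNear_of_eventually_gaussCurvature_eq_zero hk hf hN hcan hp
  refine ⟨hone, htwo, dense_iff_inter_open.2 fun O hO ⟨p, hp⟩ => ?_⟩
  by_cases h : ∃ q ∈ O, gaussCurvature f N q ≠ 0
  · obtain ⟨q, hq, hK⟩ := h
    exact ⟨q, hq, Or.inl (hone q hK)⟩
  · push Not at h
    exact ⟨p, hp, Or.inr (htwo p (Filter.eventually_of_mem (hO.mem_nhds hp) h))⟩
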